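/- Let $n$ be a number of qubits, $d=2^n$, let $P_0=\mathbb 1$ and let $\{P_k\}_{k=1}^{d^2-1}$ be the other operators in $\{\mathbb 1,\sigma_x,\sigma_y,\sigma_z\}^{\otimes n}$. Put $U_\theta=\exp\bigl(-i\sum_{k=1}^{d^2-1}\theta_kP_k\bigr)$ for $\theta\in\mathbb R^{d^2-1}$, and, for $q_1,\dots,q_{d^2-1}\ge 0$ with sum $q$, consider the Pauli-noise channel $$\mathcal E_\theta(\rho)=(1-q)\,U_\theta\rho U_\theta^\dagger+\sum_{k=1}^{d^2-1}q_k\,P_kU_\theta\rho U_\theta^\dagger P_k ,$$ which acts on the $n$-qubit probe only (an ancilla, if there is one, is noiseless). All Fisher information matrices are taken at $\theta=0$: for an input state $\psi$ and a POVM $M=\{M_x\}$, $I(\psi,M)_{jk}=\sum_{x:\,p_x\neq0}\frac{1}{p_x}\frac{\partial p_x}{\partial\theta_j}\frac{\partial p_x}{\partial\theta_k}$, where $p_x$ is the probability of outcome $x$ on the output state; if $\psi^{(i)}$ is used with (known) probability $p^{(i)}$ and is measured by $M^{(i)}$, then $I(\{p^{(i)},\psi^{(i)},M^{(i)}\})=\sum_ip^{(i)}I(\psi^{(i)},M^{(i)})$.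 Let $$w=\inf \mathrm{Tr}\bigl(I(\{p^{(i)},\psi^{(i)},M^{(i)}\})^{-1}\bigr)$$ be the noiseless optimum: $I$ is computed for the noiseless evolution $U_\theta(\cdot)U_\theta^\dagger$, and the infimum is over all finite-dimensional ancillas, all countable ensembles of pure states of probe and ancilla, and all POVMs with countably many outcomes for which $I$ is positive definite. A measurement on a $D$-dimensional space is given by a $3$-design if it is $\{w_sD\,|s\rangle\langle s|\}_s$ for finitely many weights $w_s>0$ and unit vectors $|s\rangle$ with $\sum_sw_s|s\rangle\langle s|=\mathbb 1/D$ and $\sum_sw_s(|s\rangle\langle s|)^{\otimes3}=\int(|\psi\rangle\langle\psi|)^{\otimes3}\,d\psi$, where $d\psi$ is the Haar probability measure on unit vectors. Assume that $q<\tfrac12$ and $(1-2q)^2>q$, and put $\kappa(q)=\dfrac{(1-q)^2(1-4q)}{2(2-q)}$. Then $\kappa(q)>0$, and the following hold. 1. Let $|\psi^{\mathrm{ME}}\rangle=d^{-1/2}\sum_x|x\rangle|x\rangle$ be the maximally entangled state of the probe and an $n$-qubit ancilla, and let $M$ be any $3$-design measurement on the joint space, of dimension $d^2$. Then, under the noise,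 $I(\psi^{\mathrm{ME}},M)$ is positive definite, $$I(\psi^{\mathrm{ME}},M)\succeq\kappa(q)\,\frac{d^2+2}{d^2+1}\cdot4\,\mathbb 1,\qquad \mathrm{Tr}\bigl(I(\psi^{\mathrm{ME}},M)^{-1}\bigr)\le\frac{w}{\kappa(q)} .$$ 2. Let the input be a random stabilizer state, $\psi^{(i)}=U^{(i)}|0\rangle^{\otimes n}$ with $U^{(i)}$ uniformly distributed over the $n$-qubit Clifford group modulo phases (no ancilla), and let $M$ be any $3$-design measurement on the $d$-dimensional probe space, the same for all $i$. Then, under the noise, the Fisher information matrix $I$ of this ensemble is positive definite, $$I\succeq\kappa(q)\,\frac{d+2}{d+1}\cdot\frac{4d}{d+1}\,\mathbb 1,\qquad \mathrm{Tr}(I^{-1})\le\frac{d+1}{d}\cdot\frac{w}{\kappa(q)} .$$ Thus both protocols achieve the noiseless optimum $w$ up to a factor that depends only on $q$. -/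

import Mathlib

open scoped Matrix Kronecker

namespace HamEst

noncomputable section

open scoped ComplexOrder

/-! ### Parameterized states, measurements and Fisher information -/

/-- The rank-one matrix `|ψ⟩⟨ψ|`. -/
def ketbra {S : Type*} (ψ : S → ℂ) : Matrix S S ℂ := Matrix.vecMulVec ψ (star ψ)

/-- `ψ` is a unit vector. -/
def IsKet {S : Type*} [Fintype S] (ψ : S → ℂ) : Prop := star ψ ⬝ᵥ ψ = 1

/-- A POVM with outcome set `X` (finite or countable in all uses below). -/
structure IsPOVM {S X : Type*} [Fintype S] [DecidableEq S] (M : X → Matrix S S ℂ) : Prop where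
  posSemidef : ∀ x, (M x).PosSemidef
  hasSum_one : HasSum M 1

/-- Born's rule: `Tr(ρ E)` for a state `ρ` and a measurement operator `E`. -/
def prob {S : Type*} [Fintype S] (ρ E : Matrix S S ℂ) : ℝ := (Matrix.trace (ρ * E)).re

/-- The partial derivative `∂ f / ∂ θ_j` at `θ`. -/
def partialDeriv {m : Type*} [DecidableEq m] (f : (m → ℝ) → ℝ) (θ : m → ℝ) (j : m) : ℝ :=
  lineDeriv ℝ f θ (Pi.single j 1)

open Classical in
/-- The classical Fisher information matrix at `θ` of the parameterized state `ρ` measured by `M`: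
`I_{ij} = ∑_{x, p_x ≠ 0} (∂_i p_x) (∂_j p_x) / p_x` with `p_x = Tr(ρ_θ M_x)`. -/
def cfim {m S X : Type*} [DecidableEq m] [Fintype S] (ρ : (m → ℝ) → Matrix S S ℂ)
    (M : X → Matrix S S ℂ) (θ : m → ℝ) : Matrix m m ℝ :=
  Matrix.of fun i j => ∑' x,
    if prob (ρ θ) (M x) = 0 then 0 else
      1 / prob (ρ θ) (M x) *
        (partialDeriv (fun t => prob (ρ t) (M x)) θ i *
          partialDeriv (fun t => prob (ρ t) (M x)) θ j)

/-! ### Projective 3-designs -/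

/-- `A ⊗ A ⊗ A`. -/
def tensorCube {S : Type*} (A : Matrix S S ℂ) : Matrix ((S × S) × S) ((S × S) × S) ℂ :=
  (A ⊗ₖ A) ⊗ₖ A

/-- Entrywise average of `(|ψ⟩⟨ψ|)^{⊗3}` over the uniform (Haar) probability measure on
the unit sphere of `ℂ^S`. -/
def haarThirdMoment (S : Type*) [Fintype S] :
    Matrix ((S × S) × S) ((S × S) × S) ℂ :=
  Matrix.of fun a b =>
    ⨍ ψ : Metric.sphere (0 : EuclideanSpace ℂ S) 1, tensorCube (ketbra (ψ.1.ofLp)) a b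
      ∂((MeasureTheory.volume : MeasureTheory.Measure (EuclideanSpace ℂ S)).toSphere)

/-- The weighted unit vectors `{w_s, |s⟩}` form a (complex projective) 3-design. -/
structure IsThreeDesign {S ι : Type*} [Fintype S] [DecidableEq S] [Fintype ι]
    (w : ι → ℝ) (v : ι → S → ℂ) : Prop where
  pos : ∀ s, 0 < w s
  isKet : ∀ s, IsKet (v s)
  resolution : ∑ s, (w s : ℂ) • ketbra (v s) = ((Fintype.card S : ℂ)⁻¹) • (1 : Matrix S S ℂ)
  moment : ∑ s, (w s : ℂ) • tensorCube (ketbra (v s)) = haarThirdMoment S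

/-- The measurement given by a weighted family of vectors: `M_s = w_s d |s⟩⟨s|`, where `d` is the
dimension of the measured Hilbert space. -/
def designPOVM {S ι : Type*} [Fintype S] (w : ι → ℝ) (v : ι → S → ℂ) : ι → Matrix S S ℂ :=
  fun s => ((w s : ℂ) * (Fintype.card S : ℂ)) • ketbra (v s)

/-! ### Pauli operators, Hamiltonian evolution and Pauli noise -/

/-- Labels of the computational basis of `n` qubits. -/
abbrev Qubits (n : ℕ) : Type := Fin n → Fin 2

/-- The single-qubit operators `1, σ_x, σ_y, σ_z`. -/
def sigma : Fin 4 → Matrix (Fin 2) (Fin 2) ℂ :=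
  ![1, !![0, 1; 1, 0], !![0, -Complex.I; Complex.I, 0], !![1, 0; 0, -1]]

/-- The `n`-qubit Pauli operator `σ_{k_1} ⊗ ⋯ ⊗ σ_{k_n}`. -/
def pauli {n : ℕ} (k : Fin n → Fin 4) : Matrix (Qubits n) (Qubits n) ℂ :=
  Matrix.of fun x y => ∏ i, sigma (k i) (x i) (y i)

/-- Labels of the `4 ^ n - 1` Pauli operators other than the identity. -/
abbrev PauliIdx (n : ℕ) : Type := {k : Fin n → Fin 4 // k ≠ 0}

/-- `U_θ = exp(-i ∑_k θ_k P_k)`. -/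
def evolution {n : ℕ} (θ : PauliIdx n → ℝ) : Matrix (Qubits n) (Qubits n) ℂ :=
  NormedSpace.exp (-Complex.I • ∑ k, (θ k : ℂ) • pauli k.1)

/-- `X ⊗ 1` on the probe and an ancilla `A`. -/
def onProbe {S A : Type*} [DecidableEq A] (X : Matrix S S ℂ) : Matrix (S × A) (S × A) ℂ :=
  X ⊗ₖ (1 : Matrix A A ℂ)

/-- The noisy channel
`ρ ↦ (1 - ∑_k q_k) U_θ ρ U_θ† + ∑_k q_k P_k U_θ ρ U_θ† P_k` on the probe. -/
def noisyOutput {n : ℕ} (qs : PauliIdx n → ℝ) (ρ : Matrix (Qubits n) (Qubits n) ℂ)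
    (θ : PauliIdx n → ℝ) : Matrix (Qubits n) (Qubits n) ℂ :=
  ((1 - ∑ k, qs k : ℝ) : ℂ) • (evolution θ * ρ * (evolution θ)ᴴ) +
    ∑ k, (qs k : ℂ) • (pauli k.1 * (evolution θ * ρ * (evolution θ)ᴴ) * pauli k.1)

/-- The noiseless evolution of the probe applied to a joint state of the probe and an ancilla. -/
def idealOutputAnc {n : ℕ} {A : Type*} [Fintype A] [DecidableEq A]
    (ρ : Matrix (Qubits n × A) (Qubits n × A) ℂ) (θ : PauliIdx n → ℝ) :
    Matrix (Qubits n × A) (Qubits n × A) ℂ :=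
  onProbe (evolution θ) * ρ * (onProbe (evolution θ))ᴴ

/-- The noisy channel on the probe (with no noise on the ancilla) applied to a joint state. -/
def noisyOutputAnc {n : ℕ} {A : Type*} [Fintype A] [DecidableEq A] (qs : PauliIdx n → ℝ)
    (ρ : Matrix (Qubits n × A) (Qubits n × A) ℂ) (θ : PauliIdx n → ℝ) :
    Matrix (Qubits n × A) (Qubits n × A) ℂ :=
  ((1 - ∑ k, qs k : ℝ) : ℂ) • idealOutputAnc ρ θ +
    ∑ k, (qs k : ℂ) • (onProbe (pauli k.1) * idealOutputAnc ρ θ * onProbe (pauli k.1))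

/-! ### The noiseless optimum -/

/-- The Fisher information matrix at `θ = 0` of a noiseless protocol: with probability `p i` the
input state `ψ i` (of the probe and an ancilla) is prepared, and its output is measured by `M i`;
the value of `i` is known, so the matrix is `∑ᵢ p i • I(ψ i, M i)`. -/
def idealEnsembleCfim {n : ℕ} {A : Type*} [Fintype A] [DecidableEq A] (p : ℕ → ℝ)
    (ψ : ℕ → Qubits n × A → ℂ) (M : ℕ → ℕ → Matrix (Qubits n × A) (Qubits n × A) ℂ) :
    Matrix (PauliIdx n) (PauliIdx n) ℝ :=
  Matrix.of fun j k => ∑' i, p i * cfim (idealOutputAnc (ketbra (ψ i))) (M i) 0 j k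

/-- The least weighted mean squared error `w = inf Tr(I⁻¹)` of noiseless estimation: the infimum
runs over all ancillas, all countable ensembles of pure input states and all POVMs with countably
many outcomes for which the Fisher information matrix `I` is positive definite. -/
def idealOptimum (n : ℕ) : ℝ :=
  sInf {t : ℝ | ∃ (a : ℕ) (p : ℕ → ℝ) (ψ : ℕ → Qubits n × Fin a → ℂ)
    (M : ℕ → ℕ → Matrix (Qubits n × Fin a) (Qubits n × Fin a) ℂ),
    (∀ i, 0 ≤ p i) ∧ HasSum p 1 ∧ (∀ i, IsKet (ψ i)) ∧ (∀ i, IsPOVM (M i)) ∧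
    (idealEnsembleCfim p ψ M).PosDef ∧ t = (idealEnsembleCfim p ψ M)⁻¹.trace}

/-! ### The two input ensembles -/

/-- The maximally entangled state `2^{-n/2} ∑_x |x⟩|x⟩`. -/
def maxEntangled (n : ℕ) : Qubits n × Qubits n → ℂ :=
  fun x => if x.1 = x.2 then (((Real.sqrt (2 ^ n))⁻¹ : ℝ) : ℂ) else 0

/-- Clifford unitaries: they conjugate every Pauli operator to a Pauli operator up to sign. -/
def IsClifford {n : ℕ} (U : Matrix (Qubits n) (Qubits n) ℂ) : Prop :=
  U ∈ Matrix.unitaryGroup (Qubits n) ℂ ∧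
    ∀ k, ∃ l, U * pauli k * Uᴴ = pauli l ∨ U * pauli k * Uᴴ = -pauli l

/-- Clifford unitaries that differ by a global phase are identified. -/
def phaseSetoid (n : ℕ) : Setoid {U : Matrix (Qubits n) (Qubits n) ℂ // IsClifford U} where
  r U V := ∃ z : ℂ, ‖z‖ = 1 ∧ U.1 = z • V.1
  iseqv :=
    { refl := fun U => ⟨1, by simp, by simp⟩
      symm := by
        rintro U V ⟨z, hz, h⟩
        have hz0 : z ≠ 0 := by
          intro h0
          simp [h0] at hz
        exact ⟨z⁻¹, by simp [hz], by rw [h, smul_smul, inv_mul_cancel₀ hz0, one_smul]⟩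
      trans := by
        rintro U V W ⟨z, hz, h⟩ ⟨z', hz', h'⟩
        exact ⟨z * z', by simp [hz, hz'], by rw [h, h', smul_smul]⟩ }

/-- The `n`-qubit Clifford group modulo global phases. -/
def CliffordClass (n : ℕ) : Type := Quotient (phaseSetoid n)

/-- A Clifford unitary representing a class (the state that it prepares does not depend on the
choice). -/
def CliffordClass.unitary {n : ℕ} (c : CliffordClass n) : Matrix (Qubits n) (Qubits n) ℂ :=
  (Quotient.out c).1

theorem pauli_zFlip {n : ℕ} (i : Fin n) (x y : Qubits n) :
    pauli (Pi.single i 3 : Fin n → Fin 4) x y =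
      if x = y then (if x i = 0 then 1 else -1) else 0 := by
  simp only [pauli, Matrix.of_apply]
  split_ifs with h h0
  · subst h
    refine Finset.prod_eq_one fun j _ => ?_
    by_cases hj : j = i
    · subst hj; simp [sigma, h0]
    · simp [Pi.single_eq_of_ne hj, sigma]
  · subst h
    rw [Finset.prod_eq_single i]
    · have : x i = 1 := by omega
      simp [sigma, this]
    · intro j _ hj
      simp [Pi.single_eq_of_ne hj, sigma]
    · simp
  · obtain ⟨j, hj⟩ := Function.ne_iff.mp h
    refine Finset.prod_eq_zero (Finset.mem_univ j) ?_
    by_cases hji : j = i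
    · subst hji
      have : (x j = 0 ∧ y j = 1) ∨ (x j = 1 ∧ y j = 0) := by omega
      rcases this with ⟨h1, h2⟩ | ⟨h1, h2⟩ <;> simp [sigma, h1, h2]
    · simp [Pi.single_eq_of_ne hji, sigma, hj]

theorem pauli_xFlip {n : ℕ} (b x y : Qubits n) :
    pauli (fun j => if b j = 0 then 0 else 1) x y = if y = x + b then 1 else 0 := by
  simp only [pauli, Matrix.of_apply]
  split_ifs with h
  · subst h
    refine Finset.prod_eq_one fun j _ => ?_
    rw [Pi.add_apply]
    generalize x j = u
    generalize b j = v
    fin_cases u <;> fin_cases v <;> simp [sigma]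
  · obtain ⟨j, hj⟩ := Function.ne_iff.mp h
    refine Finset.prod_eq_zero (Finset.mem_univ j) ?_
    rw [Pi.add_apply] at hj
    revert hj
    generalize x j = u
    generalize b j = v
    generalize y j = t
    fin_cases u <;> fin_cases v <;> fin_cases t <;> simp [sigma]

/-- A matrix that commutes with all Pauli operators is scalar. -/
theorem eq_smul_one_of_commute {n : ℕ} (W : Matrix (Qubits n) (Qubits n) ℂ)
    (hW : ∀ k, W * pauli k = pauli k * W) : W = W 0 0 • (1 : Matrix (Qubits n) (Qubits n) ℂ) := by
  ext x y
  by_cases hxy : x = y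
  · subst hxy
    have h := congrFun (congrFun (hW fun j => if x j = 0 then 0 else 1) 0) x
    simp only [Matrix.mul_apply, pauli_xFlip] at h
    have h2 : ∀ t : Qubits n, (x = t + x) ↔ t = 0 := fun t => by
      constructor
      · intro h
        exact (left_eq_add.mp (by rw [add_comm]; exact h))
      · rintro rfl; simp
    simp only [h2, zero_add] at h
    simpa using h.symm
  · obtain ⟨i, hi⟩ := Function.ne_iff.mp hxy
    have h := congrFun (congrFun (hW (Pi.single i 3)) x) y
    simp only [Matrix.mul_apply, pauli_zFlip] at h
    simp only [mul_ite, ite_mul, mul_zero, zero_mul, Finset.sum_ite_eq, Finset.sum_ite_eq',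
      Finset.mem_univ, if_true] at h
    rw [Matrix.smul_apply, Matrix.one_apply_ne hxy, smul_zero]
    have : (x i = 0 ∧ y i = 1) ∨ (x i = 1 ∧ y i = 0) := by omega
    rcases this with ⟨h1, h2⟩ | ⟨h1, h2⟩ <;> simp [h1, h2] at h
    · exact self_eq_neg.mp h.symm
    · exact self_eq_neg.mp h

instance instFiniteCliffordClass (n : ℕ) : Finite (CliffordClass n) := by
  let T : Set (Matrix (Qubits n) (Qubits n) ℂ) := Set.range pauli ∪ Set.range fun l => -pauli l
  have hT : T.Finite := (Set.finite_range _).union (Set.finite_range _)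
  have : Finite T := hT
  let f : CliffordClass n → (Fin n → Fin 4) → T := fun c k =>
    ⟨c.unitary * pauli k * (c.unitary)ᴴ, by
      obtain ⟨l, hl | hl⟩ := (Quotient.out c).2.2 k
      · exact Or.inl ⟨l, hl.symm⟩
      · exact Or.inr ⟨l, hl.symm⟩⟩
  refine Finite.of_injective f fun c d hcd => ?_
  have hk : ∀ k, c.unitary * pauli k * (c.unitary)ᴴ = d.unitary * pauli k * (d.unitary)ᴴ :=
    fun k => congrArg Subtype.val (congrFun hcd k)
  obtain ⟨hc1, hc2⟩ := Unitary.mem_iff.mp (Quotient.out c).2.1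
  obtain ⟨hd1, hd2⟩ := Unitary.mem_iff.mp (Quotient.out d).2.1
  change (c.unitary)ᴴ * c.unitary = 1 at hc1
  change c.unitary * (c.unitary)ᴴ = 1 at hc2
  change (d.unitary)ᴴ * d.unitary = 1 at hd1
  change d.unitary * (d.unitary)ᴴ = 1 at hd2
  generalize hU : c.unitary = U at *
  generalize hV : d.unitary = V at *
  have hcomm : ∀ k, (Vᴴ * U) * pauli k = pauli k * (Vᴴ * U) := fun k => by
    calc (Vᴴ * U) * pauli k = Vᴴ * (U * pauli k * Uᴴ) * U := by
          simp only [Matrix.mul_assoc, hc1, Matrix.mul_one]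
      _ = Vᴴ * (V * pauli k * Vᴴ) * U := by rw [hk]
      _ = (Vᴴ * V) * pauli k * (Vᴴ * U) := by simp only [Matrix.mul_assoc]
      _ = pauli k * (Vᴴ * U) := by rw [hd1, Matrix.one_mul]
  have hs := eq_smul_one_of_commute _ hcomm
  generalize (Vᴴ * U) 0 0 = z at hs
  have hUV : U = z • V := by
    calc U = V * (Vᴴ * U) := by rw [← Matrix.mul_assoc, hd2, Matrix.one_mul]
      _ = z • V := by rw [hs]; simp
  have hz : ‖z‖ = 1 := by
    have h1 : (star z * z) • (1 : Matrix (Qubits n) (Qubits n) ℂ) = 1 := by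
      have h0 := hc1
      rw [hUV, Matrix.conjTranspose_smul, Matrix.smul_mul, Matrix.mul_smul, smul_smul, hd1] at h0
      exact h0
    have h2 := congrFun (congrFun h1 0) 0
    simp only [Matrix.smul_apply, Matrix.one_apply_eq, smul_eq_mul, mul_one] at h2
    have h3 := congrArg norm h2
    rw [norm_mul, norm_star, norm_one] at h3
    nlinarith [norm_nonneg z]
  rw [← Quotient.out_eq c, ← Quotient.out_eq d]
  exact Quotient.sound ⟨z, hz, by rw [← hU, ← hV] at hUV; exact hUV⟩

instance instFintypeCliffordClass (n : ℕ) : Fintype (CliffordClass n) := Fintype.ofFinite _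

/-- The stabilizer state `U|0⋯0⟩`. -/
def stabilizerKet {n : ℕ} (c : CliffordClass n) : Qubits n → ℂ :=
  c.unitary.mulVec (Pi.single 0 1)

/-! ### The two protocols under noise -/

/-- Fisher information matrix at `θ = 0` of the maximally entangled input state, sent through the
noisy channel and measured by `M`. -/
def maxEntangledCfim {n : ℕ} {X : Type*} (qs : PauliIdx n → ℝ)
    (M : X → Matrix (Qubits n × Qubits n) (Qubits n × Qubits n) ℂ) :
    Matrix (PauliIdx n) (PauliIdx n) ℝ :=
  cfim (noisyOutputAnc qs (ketbra (maxEntangled n))) M 0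

/-- Fisher information matrix at `θ = 0` of the random stabilizer state ensemble (a uniformly
random Clifford unitary applied to `|0⋯0⟩`), sent through the noisy channel and measured by `M`. -/
def stabilizerCfim {n : ℕ} {X : Type*} (qs : PauliIdx n → ℝ)
    (M : X → Matrix (Qubits n) (Qubits n) ℂ) : Matrix (PauliIdx n) (PauliIdx n) ℝ :=
  ∑ c : CliffordClass n, (Fintype.card (CliffordClass n) : ℝ)⁻¹ •
    cfim (noisyOutput qs (ketbra (stabilizerKet c))) M 0

/-- The constant `(1 - q)² (1 - 4q) / (2 (2 - q))`, which depends on the total noise rate only. -/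
def noiseConst (q : ℝ) : ℝ := (1 - q) ^ 2 * (1 - 4 * q) / (2 * (2 - q))

end

end HamEst

namespace HamEst

noncomputable section

open scoped ComplexOrder

/-! Fix a direction `c`, put `H = ∑ c_k P_k`, and let `Y = -i[H, |ψ⟩⟨ψ|]` be the noiseless velocity
of the state. The noise is a linear map, so under it the outcome probabilities and their derivatives
along `c` are the Born values of `R`, the noisy input state, and of `X`, the noisy `Y`. The
quadratic form of the Fisher matrix is a sum of terms `A² / p`, and the tangent inequality `A² / p ≥
2 A g - g² p` removes the denominator for every choice of `g`. With `g_s = l ⟨s|Y|s⟩` the sum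
involves only second and third moments of the measurement vectors, which a 3-design shares with Haar
measure: they reduce to `Tr(XY)`, `Tr(Y²)` and `Tr(Y²R)`.

Three facts on the velocity finish this bound (`IsThreeDesign.le_cfim_noiseMap`). If `V` is the
variance of `H`, then `Tr(Y²) = 2V` and `Y² ≤ V` (`velocity_mul_self`), and Pauli noise of total
rate `q` keeps `Tr(XY) ≥ (1 - 2q) Tr(Y²)` (`prob_noiseMap_self_ge`). The best `l` gives Fisher
information at least `(1 - 2q)² (D + 2)/(D + 1) V` in dimension `D`, and `(1 - 2q)² ≥ 4κ(q)`.

The variance is `c ⬝ᵥ c` for the maximally entangled state, because the Paulis are orthogonal and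
traceless. For random stabilizer states its mean is `d/(d + 1)` times that: Pauli conjugation
removes the mixed terms, the Clifford involutions `(P_i + P_j)/√2` make the mean of `⟨P_k⟩²`
independent of `k ≠ 0`, and purity fixes its value.

It remains to compare with `w`. By Cauchy-Schwarz every diagonal entry of a noiseless Fisher matrix
is at most `4`, hence `w ≥ (d² - 1)/4`, while a bound `I ≥ k` gives `Tr(I⁻¹) ≤ (d² - 1)/k`. The Haar
third moment is computed from unitary invariance alone, by phase changes and plane reflections
(`haarThirdMoment_eq_permSum`). -/

open MeasureTheory in
/-- The uniform probability measure on the unit sphere of `ℂ^S`. -/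
def sphereMeasure (S : Type*) [Fintype S] :
    Measure (Metric.sphere (0 : EuclideanSpace ℂ S) 1) :=
  ((volume : Measure (EuclideanSpace ℂ S)).toSphere Set.univ)⁻¹ •
    (volume : Measure (EuclideanSpace ℂ S)).toSphere

/-! ### Unitary invariance of the uniform measure on the sphere -/

section Sphere

open MeasureTheory
open scoped Pointwise

variable {S : Type*} [Fintype S]

instance isProbabilityMeasure_sphereMeasure [Nonempty S] :
    IsProbabilityMeasure (sphereMeasure S) := by
  have : NeZero (volume : Measure (EuclideanSpace ℂ S)).toSphere :=
    ⟨Measure.toSphere_ne_zero _⟩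
  unfold sphereMeasure
  infer_instance

/-- A linear isometry of `ℂ^S` preserves the uniform measure on the sphere. -/
theorem measurePreserving_sphere (e : EuclideanSpace ℂ S ≃ₗᵢ[ℂ] EuclideanSpace ℂ S) :
    MeasurePreserving
      (fun x : Metric.sphere (0 : EuclideanSpace ℂ S) 1 =>
        (⟨e x.1, by simp⟩ : Metric.sphere (0 : EuclideanSpace ℂ S) 1))
      (sphereMeasure S) (sphereMeasure S) := by
  refine MeasurePreserving.smul_measure ?_ _
  let e' : EuclideanSpace ℂ S ≃ₗᵢ[ℝ] EuclideanSpace ℂ S :=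
    { e.toLinearEquiv.restrictScalars ℝ with norm_map' := e.norm_map }
  have hmeas : Measurable (fun x : Metric.sphere (0 : EuclideanSpace ℂ S) 1 =>
        (⟨e x.1, by simp⟩ : Metric.sphere (0 : EuclideanSpace ℂ S) 1)) := by
    apply Continuous.measurable
    exact (e.continuous.comp continuous_subtype_val).subtype_mk _
  refine ⟨hmeas, Measure.ext fun s hs => ?_⟩
  rw [Measure.map_apply hmeas hs, Measure.toSphere_apply' _ (hmeas hs),
    Measure.toSphere_apply' _ hs]
  congr 1
  -- `toSphere` measures a set by the volume of the cone over it, and a linear isometry carries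
  -- cones to cones while preserving volume.
  have hpre : Set.Ioo (0 : ℝ) 1 • (Subtype.val ''
      ((fun x : Metric.sphere (0 : EuclideanSpace ℂ S) 1 =>
        (⟨e x.1, by simp⟩ : Metric.sphere (0 : EuclideanSpace ℂ S) 1)) ⁻¹' s)) =
      e' ⁻¹' (Set.Ioo (0 : ℝ) 1 • (Subtype.val '' s)) := by
    ext x
    simp only [Set.mem_smul, Set.mem_image, Set.mem_preimage]
    constructor
    · rintro ⟨r, hr, _, ⟨y, hy, rfl⟩, rfl⟩
      exact ⟨r, hr, _, ⟨_, hy, rfl⟩, (e'.map_smul r y.1).symm⟩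
    · rintro ⟨r, hr, _, ⟨y, hy, rfl⟩, hx⟩
      refine ⟨r, hr, _, ⟨⟨e.symm y.1, by simp⟩, by simpa using hy, rfl⟩, ?_⟩
      apply e'.injective
      rw [← hx, e'.map_smul]
      congr 1
      exact e.apply_symm_apply _
  rw [hpre]
  exact (e'.measurePreserving).measure_preimage_equiv (f := e'.toMeasurableEquiv) _

theorem integral_sphere_comp {F : Type*} [NormedAddCommGroup F] [NormedSpace ℝ F]
    (e : EuclideanSpace ℂ S ≃ₗᵢ[ℂ] EuclideanSpace ℂ S) (f : EuclideanSpace ℂ S → F)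
    (hf : Continuous f) :
    ∫ x : Metric.sphere (0 : EuclideanSpace ℂ S) 1, f (e x.1) ∂(sphereMeasure S) =
      ∫ x : Metric.sphere (0 : EuclideanSpace ℂ S) 1, f x.1 ∂(sphereMeasure S) := by
  have h := measurePreserving_sphere e
  have h2 := integral_map (μ := sphereMeasure S) h.measurable.aemeasurable
    (f := fun x => f x.1)
    ((hf.comp continuous_subtype_val).aestronglyMeasurable)
  rw [h.map_eq] at h2
  exact h2.symm

theorem integral_sphere_mulVec [DecidableEq S] {F : Type*} [NormedAddCommGroup F]
    [NormedSpace ℝ F] (U : Matrix S S ℂ) (hU : U ∈ Matrix.unitaryGroup S ℂ) (f : (S → ℂ) → F)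
    (hf : Continuous f) :
    ∫ x : Metric.sphere (0 : EuclideanSpace ℂ S) 1, f (U *ᵥ x.1.ofLp) ∂(sphereMeasure S) =
      ∫ x : Metric.sphere (0 : EuclideanSpace ℂ S) 1, f x.1.ofLp ∂(sphereMeasure S) := by
  let u : unitary (EuclideanSpace ℂ S →L[ℂ] EuclideanSpace ℂ S) :=
    ⟨Matrix.toEuclideanCLM (𝕜 := ℂ) U, Unitary.map_mem (Matrix.toEuclideanCLM (𝕜 := ℂ)) hU⟩
  exact integral_sphere_comp (Unitary.linearIsometryEquiv u) (fun x => f x.ofLp)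
    (hf.comp (PiLp.continuous_ofLp 2 _))

theorem integrable_sphere [Nonempty S] {F : Type*} [NormedAddCommGroup F]
    (f : (S → ℂ) → F) (hf : Continuous f) :
    Integrable (fun x : Metric.sphere (0 : EuclideanSpace ℂ S) 1 => f x.1.ofLp)
      (sphereMeasure S) :=
  Continuous.integrable_of_hasCompactSupport
    (hf.comp ((PiLp.continuous_ofLp 2 _).comp continuous_subtype_val))
    (HasCompactSupport.of_compactSpace _)

end Sphere

/-! ### Sixth-order moments of the moduli of the coordinates -/

section SphereMoments

open MeasureTheory

variable {S : Type*} [Fintype S] [DecidableEq S]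

/-- The orthogonal reflection `[[c, s], [s, -c]]` in the coordinates `i`, `j`. -/
def planeReflection (i j : S) (c s : ℂ) : Matrix S S ℂ :=
  1 + Matrix.single i i (c - 1) + Matrix.single i j s + Matrix.single j i s +
    Matrix.single j j (-c - 1)

theorem planeReflection_mem {i j : S} (hij : i ≠ j) {c s : ℝ} (h : c ^ 2 + s ^ 2 = 1) :
    planeReflection i j c s ∈ Matrix.unitaryGroup S ℂ := by
  have h' : (c : ℂ) ^ 2 + (s : ℂ) ^ 2 = 1 := by exact_mod_cast h
  have hstar : star (planeReflection i j (c : ℂ) s) = planeReflection i j (c : ℂ) s := by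
    simp only [planeReflection, Matrix.star_eq_conjTranspose, Matrix.conjTranspose_add,
      Matrix.conjTranspose_single, Matrix.conjTranspose_one, star_sub, star_neg, star_one]
    simp only [RCLike.star_def, Complex.conj_ofReal]
    abel
  rw [Matrix.mem_unitaryGroup_iff, hstar]
  have h1 : ∀ (a b : S) (x y : ℂ), Matrix.single a i x * Matrix.single j b y = 0 :=
    fun a b x y => Matrix.single_mul_single_of_ne x a i j hij y
  have h2 : ∀ (a b : S) (x y : ℂ), Matrix.single a j x * Matrix.single i b y = 0 :=
    fun a b x y => Matrix.single_mul_single_of_ne x a j i hij.symm y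
  simp only [planeReflection, add_mul, mul_add, Matrix.single_mul_single_same, one_mul, mul_one,
    h1, h2, add_zero]
  have h3 : ∀ (a b : S) (x : ℂ), Matrix.single a b x = x • Matrix.single a b (1 : ℂ) :=
    fun a b x => by rw [Matrix.smul_single, smul_eq_mul, mul_one]
  rw [h3 i i (c - 1), h3 j j (-c - 1), h3 i j s, h3 j i s, h3 i i ((c - 1) * (c - 1)),
    h3 i i (s * s), h3 i j ((c - 1) * s), h3 i j (s * (-c - 1)), h3 j i (s * (c - 1)),
    h3 j i ((-c - 1) * s), h3 j j (s * s), h3 j j ((-c - 1) * (-c - 1))]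
  ext a b
  simp only [Matrix.add_apply, Matrix.smul_apply, smul_eq_mul]
  linear_combination (Matrix.single i i (1 : ℂ) a b + Matrix.single j j (1 : ℂ) a b) * h'

theorem planeReflection_mulVec_left {i j : S} (hij : i ≠ j) (c s : ℂ) (x : S → ℂ) :
    (planeReflection i j c s *ᵥ x) i = c * x i + s * x j := by
  simp [planeReflection, Matrix.add_mulVec, Matrix.single_mulVec_eq, hij]
  ring

theorem planeReflection_mulVec_right {i j : S} (hij : i ≠ j) (c s : ℂ) (x : S → ℂ) :
    (planeReflection i j c s *ᵥ x) j = s * x i - c * x j := by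
  simp [planeReflection, Matrix.add_mulVec, Matrix.single_mulVec_eq, hij.symm]
  ring

theorem planeReflection_mulVec_of_ne {i j k : S} (hi : k ≠ i) (hj : k ≠ j) (c s : ℂ)
    (x : S → ℂ) : (planeReflection i j c s *ᵥ x) k = x k := by
  simp [planeReflection, Matrix.add_mulVec, Matrix.single_mulVec_eq, hi, hj]

/-- Multiplication of the coordinate `i` by `z`. -/
def phaseMatrix (i : S) (z : ℂ) : Matrix S S ℂ := Matrix.diagonal (Function.update 1 i z)

theorem phaseMatrix_mem (i : S) {z : ℂ} (hz : z * star z = 1) :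
    phaseMatrix i z ∈ Matrix.unitaryGroup S ℂ := by
  rw [Matrix.mem_unitaryGroup_iff, phaseMatrix, Matrix.star_eq_conjTranspose,
    Matrix.diagonal_conjTranspose, Matrix.diagonal_mul_diagonal, ← Matrix.diagonal_one]
  congr 1
  ext j
  by_cases h : j = i
  · subst h; simpa using hz
  · simp [h]

theorem phaseMatrix_mulVec (i : S) (z : ℂ) (x : S → ℂ) (k : S) :
    (phaseMatrix i z *ᵥ x) k = if k = i then z * x k else x k := by
  rw [phaseMatrix, Matrix.mulVec_diagonal]
  by_cases h : k = i
  · subst h; simp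
  · simp [h]

/-- The average of `f` over the unit sphere of `ℂ^S`. -/
def sphereAvg {F : Type*} [NormedAddCommGroup F] [NormedSpace ℝ F] (f : (S → ℂ) → F) : F :=
  ∫ x : Metric.sphere (0 : EuclideanSpace ℂ S) 1, f x.1.ofLp ∂(sphereMeasure S)

section Real

variable [Nonempty S]

omit [DecidableEq S] in
theorem sphereAvg_add {F : Type*} [NormedAddCommGroup F] [NormedSpace ℝ F]
    {f g : (S → ℂ) → F} (hf : Continuous f) (hg : Continuous g) :
    sphereAvg (fun x => f x + g x) = sphereAvg f + sphereAvg g :=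
  integral_add (integrable_sphere f hf) (integrable_sphere g hg)

omit [DecidableEq S] [Nonempty S] in
theorem sphereAvg_const_mul (c : ℝ) (f : (S → ℂ) → ℝ) :
    sphereAvg (fun x => c * f x) = c * sphereAvg f :=
  integral_const_mul c _

/-- The third-order moments of `|x_i|²`. -/
def tripleMoment (i j k : S) : ℝ :=
  sphereAvg fun x => Complex.normSq (x i) * Complex.normSq (x j) * Complex.normSq (x k)

omit [Nonempty S] in
theorem avg_phase_reflection {i j : S} (hij : i ≠ j) {c s : ℝ} (h : c ^ 2 + s ^ 2 = 1)
    {z : ℂ} (hz : z * star z = 1) (f : (S → ℂ) → ℝ) (hf : Continuous f) :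
    sphereAvg (fun x => f (planeReflection i j c s *ᵥ (phaseMatrix j z *ᵥ x))) = sphereAvg f := by
  have h1 := integral_sphere_mulVec _ (planeReflection_mem hij h) f hf
  have h2 := integral_sphere_mulVec _ (phaseMatrix_mem j hz)
    (fun x => f (planeReflection i j c s *ᵥ x)) (by fun_prop)
  exact h2.trans h1

omit [Nonempty S] in
theorem tripleMoment_swap {i j : S} (hij : i ≠ j) :
    tripleMoment i i i = tripleMoment j j j := by
  have h := avg_phase_reflection hij (c := 0) (s := 1) (by norm_num) (z := 1) (by simp)
    (fun x => Complex.normSq (x i) * Complex.normSq (x i) * Complex.normSq (x i))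
    (by have := Complex.continuous_normSq; fun_prop)
  simp only [planeReflection_mulVec_left hij, phaseMatrix_mulVec] at h
  simpa [tripleMoment] using h.symm

omit [Nonempty S] in
theorem tripleMoment_symm {i j : S} (hij : i ≠ j) : tripleMoment i i j = tripleMoment j j i := by
  have hc := Complex.continuous_normSq
  have h := avg_phase_reflection hij (c := 0) (s := 1) (by norm_num) (z := 1) (by simp)
    (fun x => Complex.normSq (x i) * Complex.normSq (x i) * Complex.normSq (x j)) (by fun_prop)
  simp only [planeReflection_mulVec_left hij, planeReflection_mulVec_right hij,
    phaseMatrix_mulVec] at h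
  simpa [tripleMoment, hij] using h.symm

/-- Averaging a reflection over the phases `1, -1, i, -i` of one coordinate. -/
theorem four_mul_avg {i j : S} (hij : i ≠ j) (f : (S → ℂ) → ℝ) (hf : Continuous f) :
    4 * sphereAvg f = sphereAvg fun x =>
      f (planeReflection i j (3 / 5 : ℝ) (4 / 5 : ℝ) *ᵥ (phaseMatrix j 1 *ᵥ x)) +
      f (planeReflection i j (3 / 5 : ℝ) (4 / 5 : ℝ) *ᵥ (phaseMatrix j (-1) *ᵥ x)) +
      f (planeReflection i j (3 / 5 : ℝ) (4 / 5 : ℝ) *ᵥ (phaseMatrix j Complex.I *ᵥ x)) +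
      f (planeReflection i j (3 / 5 : ℝ) (4 / 5 : ℝ) *ᵥ (phaseMatrix j (-Complex.I) *ᵥ x)) := by
  -- The Pythagorean pair `3/5, 4/5` keeps the coefficients rational; any reflection mixing the two
  -- coordinates with both coefficients nonzero would serve.
  have key := fun (z : ℂ) (hz : z * star z = 1) =>
    avg_phase_reflection hij (c := 3 / 5) (s := 4 / 5) (by norm_num) (z := z) hz f hf
  rw [sphereAvg_add (by fun_prop) (by fun_prop), sphereAvg_add (by fun_prop) (by fun_prop),
    sphereAvg_add (by fun_prop) (by fun_prop), key 1 (by simp), key (-1) (by simp),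
    key Complex.I (by simp), key (-Complex.I) (by simp)]
  ring

/-- Invariance under a reflection with coefficients `c, s`, averaged over phases, gives `(1 - c⁶ -
s⁶) M_iii = 9 c² s² (c² + s²) M_iij`, and `1 - c⁶ - s⁶ = 3 c² s²` when `c² + s² = 1`. -/
theorem tripleMoment_iij {i j : S} (hij : i ≠ j) :
    tripleMoment i i i = 3 * tripleMoment i i j := by
  have hc := Complex.continuous_normSq
  have h := four_mul_avg hij
    (fun x => Complex.normSq (x i) * Complex.normSq (x i) * Complex.normSq (x i)) (by fun_prop)
  -- Cross terms of `|cu + szv|⁶` carry `z` to a nonzero power of modulus at most `3`, and such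
  -- powers sum to zero over the fourth roots of unity.
  have e : ∀ u v : ℂ, ∀ g : ℂ → ℝ, (∀ z, g z = Complex.normSq (((3 / 5 : ℝ) : ℂ) * u +
      ((4 / 5 : ℝ) : ℂ) * (z * v))) →
      g 1 * g 1 * g 1 + g (-1) * g (-1) * g (-1) + g Complex.I * g Complex.I * g Complex.I +
        g (-Complex.I) * g (-Complex.I) * g (-Complex.I) =
      (4 * (3 / 5) ^ 6) * (Complex.normSq u * Complex.normSq u * Complex.normSq u) +
      (36 * (3 / 5) ^ 4 * (4 / 5) ^ 2) * (Complex.normSq u * Complex.normSq u * Complex.normSq v) +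
      (36 * (3 / 5) ^ 2 * (4 / 5) ^ 4) * (Complex.normSq v * Complex.normSq v * Complex.normSq u) +
      (4 * (4 / 5) ^ 6) * (Complex.normSq v * Complex.normSq v * Complex.normSq v) := by
    intro u v g hg
    obtain ⟨a, b⟩ := u
    obtain ⟨p, q⟩ := v
    simp only [hg, Complex.normSq_apply, Complex.add_re, Complex.add_im, 
      Complex.mul_re, Complex.mul_im, Complex.one_re, Complex.one_im,
      Complex.neg_re, Complex.neg_im, Complex.I_re, Complex.I_im, Complex.ofReal_re, Complex.ofReal_im]
    ring
  simp only [planeReflection_mulVec_left hij, phaseMatrix_mulVec, if_true, if_neg hij] at h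
  have h2 : (fun x : S → ℂ => _) = fun x => _ := funext fun x => e (x i) (x j) _ fun z => rfl
  rw [h2, sphereAvg_add (by fun_prop) (by fun_prop), sphereAvg_add (by fun_prop) (by fun_prop),
    sphereAvg_add (by fun_prop) (by fun_prop)] at h
  simp only [sphereAvg_const_mul] at h
  have hs := tripleMoment_symm hij
  have hs3 := tripleMoment_swap hij
  simp only [tripleMoment] at hs hs3 ⊢
  rw [← hs, ← hs3] at h
  linarith

/-- The same averaging with `|x_k|²` as a spectator gives `(1 - c⁴ - s⁴) M_iik = 4 c² s² M_ijk`,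
using `M_iik = M_jjk`; here `1 - c⁴ - s⁴ = 2 c² s²` and `M_iik = M_iii / 3`. -/
theorem tripleMoment_ijk {i j k : S} (hij : i ≠ j) (hik : k ≠ i) (hjk : k ≠ j) :
    tripleMoment i i i = 6 * tripleMoment i j k := by
  have hc := Complex.continuous_normSq
  have h := four_mul_avg hij
    (fun x => Complex.normSq (x i) * Complex.normSq (x i) * Complex.normSq (x k)) (by fun_prop)
  have e : ∀ u v : ℂ, ∀ t : ℝ, ∀ g : ℂ → ℝ, (∀ z, g z = Complex.normSq (((3 / 5 : ℝ) : ℂ) * u +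
      ((4 / 5 : ℝ) : ℂ) * (z * v))) →
      g 1 * g 1 * t + g (-1) * g (-1) * t + g Complex.I * g Complex.I * t +
        g (-Complex.I) * g (-Complex.I) * t =
      (4 * (3 / 5) ^ 4) * (Complex.normSq u * Complex.normSq u * t) +
      (16 * (3 / 5) ^ 2 * (4 / 5) ^ 2) * (Complex.normSq u * Complex.normSq v * t) +
      (4 * (4 / 5) ^ 4) * (Complex.normSq v * Complex.normSq v * t) := by
    intro u v t g hg
    obtain ⟨a, b⟩ := u
    obtain ⟨p, q⟩ := v
    simp only [hg, Complex.normSq_apply, Complex.add_re, Complex.add_im, 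
      Complex.mul_re, Complex.mul_im, Complex.one_re, Complex.one_im,
      Complex.neg_re, Complex.neg_im, Complex.I_re, Complex.I_im, Complex.ofReal_re, Complex.ofReal_im]
    ring
  simp only [planeReflection_mulVec_left hij, planeReflection_mulVec_of_ne hik hjk,
    phaseMatrix_mulVec, if_true, if_neg hij, if_neg hjk] at h
  have h2 : (fun x : S → ℂ => _) = fun x => _ :=
    funext fun x => e (x i) (x j) (Complex.normSq (x k)) _ fun z => rfl
  rw [h2, sphereAvg_add (by fun_prop) (by fun_prop),
    sphereAvg_add (by fun_prop) (by fun_prop)] at h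
  simp only [sphereAvg_const_mul] at h
  have h3 := tripleMoment_iij hik.symm
  have h4 := tripleMoment_iij hjk.symm
  have hs3 := tripleMoment_swap hij
  simp only [tripleMoment] at h3 h4 hs3 ⊢
  linarith

end Real
end SphereMoments

/-! ### The third Haar moment as a multiple of the sum of permutations -/

section HaarMoment

open MeasureTheory

variable {S : Type*} [Fintype S] [DecidableEq S]

omit [DecidableEq S] in
theorem haarThirdMoment_apply (a b : (S × S) × S) :
    haarThirdMoment S a b = sphereAvg fun x : S → ℂ =>
      x a.1.1 * star (x b.1.1) * (x a.1.2 * star (x b.1.2)) * (x a.2 * star (x b.2)) := rfl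

/-- The number of entries of `a` equal to `i`. -/
def tripleCount (i : S) (a : (S × S) × S) : ℕ :=
  (if a.1.1 = i then 1 else 0) + (if a.1.2 = i then 1 else 0) + (if a.2 = i then 1 else 0)

omit [Fintype S] in
theorem tripleCount_lt (i : S) (a : (S × S) × S) : tripleCount i a < 4 := by
  unfold tripleCount
  split_ifs <;> simp

/-- The product is `i^(k - l)` with `0 < |k - l| < 4`. Hence the single phase `i` already separates
all possible multiplicities of an index in a triple. -/
theorem I_pow_mul_ne_one {k l : ℕ} (hk : k < 4) (hl : l < 4) (h : k ≠ l) :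
    Complex.I ^ k * star Complex.I ^ l ≠ 1 := by
  have h1 : star Complex.I = -Complex.I := by simp
  rw [h1]
  intro h0
  have hre := congrArg Complex.re h0
  clear h0
  interval_cases k <;> interval_cases l <;>
    first | exact h rfl | norm_num [pow_succ] at hre

/-- Multiplying the coordinate `i` by the phase `i ∈ ℂ` leaves the average unchanged but multiplies
the integrand by a number different from `1`. -/
theorem haarThirdMoment_phase (a b : (S × S) × S) (i : S)
    (h : tripleCount i a ≠ tripleCount i b) : haarThirdMoment S a b = 0 := by
  have h1 := integral_sphere_mulVec _ (phaseMatrix_mem i (z := Complex.I) (by simp))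
    (fun x : S → ℂ =>
      x a.1.1 * star (x b.1.1) * (x a.1.2 * star (x b.1.2)) * (x a.2 * star (x b.2)))
    (by fun_prop)
  change _ = haarThirdMoment S a b at h1
  have e : ∀ (k : S) (x : S → ℂ), (phaseMatrix i Complex.I *ᵥ x) k =
      Complex.I ^ (if k = i then 1 else 0) * x k := by
    intro k x
    rw [phaseMatrix_mulVec]
    split_ifs <;> simp
  have e2 : ∀ x : S → ℂ, (phaseMatrix i Complex.I *ᵥ x) a.1.1 *
      star ((phaseMatrix i Complex.I *ᵥ x) b.1.1) * ((phaseMatrix i Complex.I *ᵥ x) a.1.2 *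
      star ((phaseMatrix i Complex.I *ᵥ x) b.1.2)) * ((phaseMatrix i Complex.I *ᵥ x) a.2 *
      star ((phaseMatrix i Complex.I *ᵥ x) b.2)) =
      (Complex.I ^ tripleCount i a * star Complex.I ^ tripleCount i b) *
        (x a.1.1 * star (x b.1.1) * (x a.1.2 * star (x b.1.2)) * (x a.2 * star (x b.2))) := by
    intro x
    simp only [e, tripleCount, pow_add, star_mul', star_pow]
    ring
  simp only [e2] at h1
  rw [integral_const_mul] at h1
  change _ * haarThirdMoment S a b = _ at h1
  have h0 := I_pow_mul_ne_one (tripleCount_lt i a) (tripleCount_lt i b) h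
  have : (Complex.I ^ tripleCount i a * star Complex.I ^ tripleCount i b - 1) *
      haarThirdMoment S a b = 0 := by linear_combination h1
  exact (mul_eq_zero.mp this).resolve_left (sub_ne_zero.mpr h0)

omit [DecidableEq S] in
theorem haarThirdMoment_diag (i j k : S) :
    haarThirdMoment S ((i, j), k) ((i, j), k) = tripleMoment i j k := by
  rw [haarThirdMoment_apply, tripleMoment, sphereAvg, sphereAvg, ← integral_complex_ofReal]
  congr 1
  ext x
  simp [Complex.mul_conj]

/-- `1` if `a = b` and `0` otherwise. -/
def delta (a b : S) : ℂ := if a = b then 1 else 0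

/-- The sum of the six permutation operators on the third tensor power. -/
def permSum (a b : (S × S) × S) : ℂ :=
  delta a.1.1 b.1.1 * delta a.1.2 b.1.2 * delta a.2 b.2 +
  delta a.1.1 b.1.1 * delta a.1.2 b.2 * delta a.2 b.1.2 +
  delta a.1.1 b.1.2 * delta a.1.2 b.1.1 * delta a.2 b.2 +
  delta a.1.1 b.1.2 * delta a.1.2 b.2 * delta a.2 b.1.1 +
  delta a.1.1 b.2 * delta a.1.2 b.1.1 * delta a.2 b.1.2 +
  delta a.1.1 b.2 * delta a.1.2 b.1.2 * delta a.2 b.1.1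

/-- Triples with equal multiplicities are permutations of each other. It is enough to compare the
multiplicities of `l`, `m` and `n`. -/
theorem perm_or_exists_count (i j k l m n : S) :
    (l = i ∧ m = j ∧ n = k) ∨ (l = i ∧ m = k ∧ n = j) ∨ (l = j ∧ m = i ∧ n = k) ∨
    (l = j ∧ m = k ∧ n = i) ∨ (l = k ∧ m = i ∧ n = j) ∨ (l = k ∧ m = j ∧ n = i) ∨
    (permSum ((i, j), k) ((l, m), n) = 0 ∧
      ∃ x, tripleCount x ((i, j), k) ≠ tripleCount x ((l, m), n)) := by
  by_contra! h
  obtain ⟨h1, h2, h3, h4, h5, h6, h7⟩ := h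
  have h0 : permSum ((i, j), k) ((l, m), n) = 0 := by
    simp only [permSum, delta]
    grind
  have h8 := h7 h0
  simp only [tripleCount] at h8
  have a1 := h8 l
  have a2 := h8 m
  have a3 := h8 n
  clear h8 h7 h0
  grind

/-- The diagonal value of `permSum` is the order of the stabilizer of the triple: `6`, `2` or `1`
according to the coincidences. The moments are in the same ratio. -/
theorem permSum_diag [Nonempty S] (s i j k : S) :
    (tripleMoment i j k : ℂ) = tripleMoment s s s / 6 * permSum ((i, j), k) ((i, j), k) := by
  have h3 : ∀ i : S, tripleMoment i i i = tripleMoment s s s := fun i => by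
    by_cases h : i = s
    · rw [h]
    · exact tripleMoment_swap h
  have c1 : ∀ i j k : S, tripleMoment i j k = tripleMoment i k j := fun i j k => by
    simp only [tripleMoment, mul_right_comm]
  have c2 : ∀ i j k : S, tripleMoment i j k = tripleMoment j i k := fun i j k => by
    simp only [tripleMoment]
    congr 1; ext x; ring
  have h21 : ∀ i j : S, i ≠ j → tripleMoment i i j = tripleMoment s s s / 3 := fun i j h => by
    rw [← h3 i, tripleMoment_iij h]; ring
  by_cases hij : i = j
  · subst hij
    by_cases hik : i = k
    · subst hik
      rw [h3]; simp [permSum, delta]; ring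
    · rw [h21 i k hik]; simp [permSum, delta, hik, Ne.symm hik]; ring
  · by_cases hik : i = k
    · subst hik
      rw [c1, h21 i j hij]; simp [permSum, delta, hij, Ne.symm hij]; ring
    · by_cases hjk : j = k
      · subst hjk
        rw [c2, c1, h21 j i (Ne.symm hij)]; simp [permSum, delta, hij, Ne.symm hij]; ring
      · have := tripleMoment_ijk hij (Ne.symm hik) (Ne.symm hjk)
        rw [← h3 i, this]
        simp [permSum, delta, hij, hik, hjk, Ne.symm hij, Ne.symm hik, Ne.symm hjk]

omit [DecidableEq S] in
theorem haarThirdMoment_perm (a : (S × S) × S) (i j k : S) :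
    haarThirdMoment S a ((i, k), j) = haarThirdMoment S a ((i, j), k) ∧
    haarThirdMoment S a ((j, i), k) = haarThirdMoment S a ((i, j), k) := by
  simp only [haarThirdMoment_apply]
  constructor <;> congr 1 <;> ext x <;> ring

/-- If `b` is a permutation of `a`, the entry equals the diagonal one, because the three factors
`star (x ·)` commute; otherwise both sides vanish. The constant is fixed later by the total trace.
-/
theorem haarThirdMoment_eq [Nonempty S] (s : S) (a b : (S × S) × S) :
    haarThirdMoment S a b = tripleMoment s s s / 6 * permSum a b := by
  obtain ⟨⟨i, j⟩, k⟩ := a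
  obtain ⟨⟨l, m⟩, n⟩ := b
  have hd := permSum_diag s i j k
  rw [← haarThirdMoment_diag] at hd
  have p1 := fun (a : (S × S) × S) (i j k : S) => (haarThirdMoment_perm a i j k).1
  have p2 := fun (a : (S × S) × S) (i j k : S) => (haarThirdMoment_perm a i j k).2
  rcases perm_or_exists_count i j k l m n with ⟨rfl, rfl, rfl⟩ | ⟨rfl, rfl, rfl⟩ | ⟨rfl, rfl, rfl⟩ |
    ⟨rfl, rfl, rfl⟩ | ⟨rfl, rfl, rfl⟩ | ⟨rfl, rfl, rfl⟩ | ⟨h0, x, hx⟩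
  · exact hd
  · rw [p1, hd]; simp only [permSum]; ring
  · rw [p2, hd]; simp only [permSum]; ring
  · rw [p1, p2, hd]; simp only [permSum]; ring
  · rw [p2, p1, hd]; simp only [permSum]; ring
  · rw [p1, p2, p1, hd]; simp only [permSum]; ring
  · rw [haarThirdMoment_phase _ _ x hx, h0, mul_zero]

theorem sum_permSum_diag :
    ∑ i : S, ∑ j : S, ∑ k : S, permSum ((i, j), k) ((i, j), k) =
      (Fintype.card S : ℂ) * (Fintype.card S + 1) * (Fintype.card S + 2) := by
  simp only [permSum, delta, Finset.sum_add_distrib, mul_ite, mul_one, mul_zero,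
    Finset.sum_ite_eq', Finset.mem_univ, if_true, Finset.sum_const,
    Finset.card_univ, nsmul_eq_mul, Finset.sum_ite_irrel]
  ring

omit [DecidableEq S] in
theorem sum_haarThirdMoment_diag [Nonempty S] :
    ∑ i : S, ∑ j : S, ∑ k : S, haarThirdMoment S ((i, j), k) ((i, j), k) = 1 := by
  have hint : ∀ i j k : S, Integrable (fun x : Metric.sphere (0 : EuclideanSpace ℂ S) 1 =>
      x.1.ofLp i * star (x.1.ofLp i) * (x.1.ofLp j * star (x.1.ofLp j)) *
        (x.1.ofLp k * star (x.1.ofLp k))) (sphereMeasure S) := fun i j k =>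
    integrable_sphere (fun x : S → ℂ => x i * star (x i) * (x j * star (x j)) *
      (x k * star (x k))) (by fun_prop)
  simp only [haarThirdMoment_apply, sphereAvg]
  simp_rw [← integral_finsetSum _ fun k _ => hint _ _ k]
  simp_rw [← integral_finsetSum _ fun j _ => integrable_finsetSum _ fun k _ => hint _ j k]
  rw [← integral_finsetSum _ fun i _ => integrable_finsetSum _ fun j _ =>
    integrable_finsetSum _ fun k _ => hint i j k]
  have h1 : ∀ x : Metric.sphere (0 : EuclideanSpace ℂ S) 1,
      ∑ i, x.1.ofLp i * star (x.1.ofLp i) = 1 := by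
    intro x
    have hx : ‖x.1‖ = 1 := by simp
    have h2 := EuclideanSpace.norm_sq_eq x.1
    rw [hx] at h2
    have h3 : ((∑ i, ‖x.1.ofLp i‖ ^ 2 : ℝ) : ℂ) = 1 := by rw [← h2]; simp
    rw [← h3]
    push_cast
    refine Finset.sum_congr rfl fun i _ => ?_
    rw [RCLike.star_def, Complex.mul_conj']
  simp_rw [← Finset.mul_sum, h1, mul_one, ← Finset.mul_sum, h1, mul_one, h1]
  simp

/-- The third moment of the uniform measure on the unit sphere of `ℂ^S`. -/
theorem haarThirdMoment_eq_permSum [Nonempty S] (a b : (S × S) × S) :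
    haarThirdMoment S a b =
      ((Fintype.card S : ℂ) * (Fintype.card S + 1) * (Fintype.card S + 2))⁻¹ * permSum a b := by
  obtain ⟨s⟩ := ‹Nonempty S›
  have h := sum_haarThirdMoment_diag (S := S)
  simp only [haarThirdMoment_eq s, ← Finset.mul_sum, sum_permSum_diag] at h
  rw [haarThirdMoment_eq s, eq_inv_of_mul_eq_one_left h]

end HaarMoment

/-! ### Moments of a 3-design measurement -/

section DesignMoments

variable {S : Type*} [Fintype S] [DecidableEq S]

/-- Against each permutation operator, the trace of a tensor product factors into one trace per
cycle: the identity, three transpositions and two 3-cycles give the six terms. -/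
theorem trace_kronecker_mul_permSum (A B C : Matrix S S ℂ) :
    Matrix.trace (((A ⊗ₖ B) ⊗ₖ C) * Matrix.of permSum) =
      A.trace * B.trace * C.trace + A.trace * (B * C).trace + B.trace * (A * C).trace +
        C.trace * (A * B).trace + (A * B * C).trace + (A * C * B).trace := by
  have hexp : Matrix.trace (((A ⊗ₖ B) ⊗ₖ C) * Matrix.of permSum) =
      ∑ i, ∑ j, ∑ k, (A i i * B j j * C k k + A i i * B j k * C k j + A i j * B j i * C k k
        + A i k * B j i * C k j + A i j * B j k * C k i  + A i k * B j j * C k i) := by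
    simp only [Matrix.trace, Matrix.diag_apply, Matrix.mul_apply, Fintype.sum_prod_type,
      Matrix.kroneckerMap_apply, Matrix.of_apply, permSum, mul_add, Finset.sum_add_distrib, delta,
      mul_ite, mul_one, mul_zero, Finset.sum_ite_eq', Finset.mem_univ, if_true]
    ring
  rw [hexp]
  simp only [Finset.sum_add_distrib]
  have t1 : A.trace * B.trace * C.trace = ∑ i, ∑ j, ∑ k, A i i * B j j * C k k := by
    simp only [Matrix.trace, Matrix.diag_apply, ← Finset.mul_sum, ← Finset.sum_mul]
  have t2 : A.trace * (B * C).trace = ∑ i, ∑ j, ∑ k, A i i * B j k * C k j := by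
    simp only [Matrix.trace, Matrix.diag_apply, Matrix.mul_apply, mul_assoc, ← Finset.mul_sum,
      ← Finset.sum_mul]
  have t3 : C.trace * (A * B).trace = ∑ i, ∑ j, ∑ k, A i j * B j i * C k k := by
    simp only [Matrix.trace, Matrix.diag_apply, Matrix.mul_apply, ← Finset.mul_sum,
      ← Finset.sum_mul]
    ring
  have t4 : B.trace * (A * C).trace = ∑ i, ∑ j, ∑ k, A i k * B j j * C k i := by
    simp only [Matrix.trace, Matrix.diag_apply, Matrix.mul_apply]
    rw [Finset.mul_sum]
    refine Finset.sum_congr rfl fun i _ => ?_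
    rw [Finset.sum_mul]
    refine Finset.sum_congr rfl fun j _ => ?_
    rw [Finset.mul_sum]
    exact Finset.sum_congr rfl fun k _ => by ring
  have t5 : (A * B * C).trace = ∑ i, ∑ j, ∑ k, A i j * B j k * C k i := by
    simp only [Matrix.trace, Matrix.diag_apply, Matrix.mul_apply, Finset.sum_mul]
    exact Finset.sum_congr rfl fun i _ => Finset.sum_comm
  have t6 : (A * C * B).trace = ∑ i, ∑ j, ∑ k, A i k * B j i * C k j := by
    simp only [Matrix.trace, Matrix.diag_apply, Matrix.mul_apply, Finset.sum_mul]
    exact Finset.sum_congr rfl fun i _ => Finset.sum_congr rfl fun j _ =>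
      Finset.sum_congr rfl fun k _ => by ring
  rw [t1, t2, t3, t4, t5, t6]
  ring

variable {ι : Type*} [Fintype ι] {w : ι → ℝ} {v : ι → S → ℂ}

theorem IsThreeDesign.sum_trace_mul [Nonempty S] (h : IsThreeDesign w v) (A B C : Matrix S S ℂ) :
    ∑ s, (w s : ℂ) * ((A * ketbra (v s)).trace * (B * ketbra (v s)).trace *
      (C * ketbra (v s)).trace) =
      ((Fintype.card S : ℂ) * (Fintype.card S + 1) * (Fintype.card S + 2))⁻¹ *
      (A.trace * B.trace * C.trace + A.trace * (B * C).trace + B.trace * (A * C).trace +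
        C.trace * (A * B).trace + (A * B * C).trace + (A * C * B).trace) := by
  have h1 : haarThirdMoment S = ((Fintype.card S : ℂ) * (Fintype.card S + 1) *
      (Fintype.card S + 2))⁻¹ • Matrix.of permSum := by
    ext a b
    rw [haarThirdMoment_eq_permSum]
    rfl
  have h2 := congrArg (fun T => Matrix.trace (((A ⊗ₖ B) ⊗ₖ C) * T)) h.moment
  simp only [h1, Matrix.mul_smul, Matrix.trace_smul, trace_kronecker_mul_permSum, smul_eq_mul,
    Finset.mul_sum, Matrix.trace_sum] at h2
  rw [← h2]
  refine Finset.sum_congr rfl fun s _ => ?_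
  rw [tensorCube, ← Matrix.mul_kronecker_mul, ← Matrix.mul_kronecker_mul, Matrix.trace_kronecker,
    Matrix.trace_kronecker]

omit [Fintype S] [DecidableEq S] in
theorem ketbra_isHermitian (ψ : S → ℂ) : (ketbra ψ).IsHermitian := by
  rw [Matrix.IsHermitian, ketbra, Matrix.conjTranspose_vecMulVec, star_star]

omit [DecidableEq S] in
theorem trace_mul_of_isHermitian {A B : Matrix S S ℂ} (hA : A.IsHermitian) (hB : B.IsHermitian) :
    (A * B).trace = prob A B := by
  have h : star (A * B).trace = (A * B).trace := by
    rw [← Matrix.trace_conjTranspose, Matrix.conjTranspose_mul, hA.eq, hB.eq, Matrix.trace_mul_comm]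
  exact (Complex.conj_eq_iff_re.mp h).symm

omit [DecidableEq S] in
theorem trace_mul_ketbra (A : Matrix S S ℂ) (ψ : S → ℂ) :
    (A * ketbra ψ).trace = star ψ ⬝ᵥ (A *ᵥ ψ) := by
  rw [ketbra, Matrix.mul_vecMulVec, Matrix.trace_vecMulVec, dotProduct_comm]

omit [DecidableEq S] in
theorem IsKet.trace_ketbra {ψ : S → ℂ} (h : IsKet ψ) : (ketbra ψ).trace = 1 := by
  rw [ketbra, Matrix.trace_vecMulVec, dotProduct_comm]
  exact h

/-- Second moments of a 3-design on traceless Hermitian operators. -/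
theorem IsThreeDesign.sum_prob_mul_prob [Nonempty S] (h : IsThreeDesign w v) {X Y : Matrix S S ℂ}
    (hX : X.IsHermitian) (hY : Y.IsHermitian) (hX0 : X.trace = 0) (hY0 : Y.trace = 0) :
    ∑ s, w s * (prob X (ketbra (v s)) * prob Y (ketbra (v s))) =
      prob X Y / ((Fintype.card S : ℝ) * (Fintype.card S + 1)) := by
  have h1 := h.sum_trace_mul X Y 1
  simp only [trace_mul_of_isHermitian hX (ketbra_isHermitian _),
    trace_mul_of_isHermitian hY (ketbra_isHermitian _), Matrix.one_mul, (h.isKet _).trace_ketbra,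
    mul_one, hX0, hY0, trace_mul_of_isHermitian hX hY, Matrix.trace_one] at h1
  have h2 : ((∑ s, w s * (prob X (ketbra (v s)) * prob Y (ketbra (v s))) : ℝ) : ℂ) =
      ((prob X Y / ((Fintype.card S : ℝ) * (Fintype.card S + 1)) : ℝ) : ℂ) := by
    push_cast
    rw [h1]
    have a1 : (Fintype.card S : ℂ) ≠ 0 := by exact_mod_cast Fintype.card_ne_zero
    have a2 : (Fintype.card S : ℂ) + 1 ≠ 0 := by exact_mod_cast Nat.succ_ne_zero (Fintype.card S)
    have a3 : (Fintype.card S : ℂ) + 2 ≠ 0 := by exact_mod_cast Nat.succ_ne_zero (Fintype.card S + 1)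
    field_simp
    ring
  exact_mod_cast h2

/-- Third moments of a 3-design on a traceless Hermitian operator and a state. -/
theorem IsThreeDesign.sum_prob_sq_mul_prob [Nonempty S] (h : IsThreeDesign w v)
    {Y R : Matrix S S ℂ} (hY : Y.IsHermitian) (hR : R.IsHermitian) (hY0 : Y.trace = 0)
    (hR1 : R.trace = 1) :
    ∑ s, w s * (prob Y (ketbra (v s)) ^ 2 * prob R (ketbra (v s))) =
      (prob Y Y + 2 * prob (Y * Y) R) /
        ((Fintype.card S : ℝ) * (Fintype.card S + 1) * (Fintype.card S + 2)) := by
  have h1 := h.sum_trace_mul Y Y R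
  have hYY : (Y * Y).IsHermitian := by
    rw [Matrix.IsHermitian, Matrix.conjTranspose_mul, hY.eq]
  have h3 : (Y * R * Y).trace = (Y * Y * R).trace := by
    rw [Matrix.trace_mul_comm, Matrix.mul_assoc]
  simp only [trace_mul_of_isHermitian hY (ketbra_isHermitian _), h3,
    trace_mul_of_isHermitian hR (ketbra_isHermitian _), hR1, hY0,
    trace_mul_of_isHermitian hYY hR, trace_mul_of_isHermitian hY hY] at h1
  have h2 : ((∑ s, w s * (prob Y (ketbra (v s)) ^ 2 * prob R (ketbra (v s))) : ℝ) : ℂ) =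
      (((prob Y Y + 2 * prob (Y * Y) R) /
        ((Fintype.card S : ℝ) * (Fintype.card S + 1) * (Fintype.card S + 2)) : ℝ) : ℂ) := by
    push_cast
    simp only [pow_two]
    rw [h1]
    ring
  exact_mod_cast h2

end DesignMoments

/-! ### Born probabilities and the velocity of a pure state -/

section Prob

variable {S : Type*} [Fintype S]

theorem prob_add (A B E : Matrix S S ℂ) : prob (A + B) E = prob A E + prob B E := by
  simp [prob, add_mul]

theorem prob_sub (A B E : Matrix S S ℂ) : prob (A - B) E = prob A E - prob B E := by
  simp [prob, sub_mul]

theorem prob_smul (c : ℝ) (A E : Matrix S S ℂ) : prob ((c : ℂ) • A) E = c * prob A E := by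
  simp [prob]

theorem prob_sum {m : Type*} (s : Finset m) (A : m → Matrix S S ℂ) (E : Matrix S S ℂ) :
    prob (∑ k ∈ s, A k) E = ∑ k ∈ s, prob (A k) E := by
  simp [prob, Finset.sum_mul, Matrix.trace_sum]

theorem prob_comm (A B : Matrix S S ℂ) : prob A B = prob B A := by
  rw [prob, prob, Matrix.trace_mul_comm]

theorem prob_nonneg {A B : Matrix S S ℂ} (hA : A.PosSemidef) (hB : B.PosSemidef) :
    0 ≤ prob A B := by
  classical
  obtain ⟨C, rfl⟩ : ∃ C, B = star C * C := by
    open scoped MatrixOrder Matrix.Norms.L2Operator in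
    exact CStarAlgebra.nonneg_iff_eq_star_mul_self.mp hB.nonneg
  have h := (hA.mul_mul_conjTranspose_same C).trace_nonneg
  rw [prob, ← Matrix.mul_assoc, Matrix.trace_mul_comm, ← Matrix.mul_assoc]
  exact (Complex.le_def.mp h).1

/-- The Cauchy-Schwarz inequality for the form defined by a positive semidefinite matrix. -/
theorem norm_sq_dotProduct_mulVec_le {M : Matrix S S ℂ} (hM : M.PosSemidef) (x y : S → ℂ) :
    ‖star x ⬝ᵥ (M *ᵥ y)‖ ^ 2 ≤ (star x ⬝ᵥ (M *ᵥ x)).re * (star y ⬝ᵥ (M *ᵥ y)).re := by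
  classical
  obtain ⟨C, rfl⟩ : ∃ C, M = star C * C := by
    open scoped MatrixOrder Matrix.Norms.L2Operator in
    exact CStarAlgebra.nonneg_iff_eq_star_mul_self.mp hM.nonneg
  have h : ∀ a b : S → ℂ, star a ⬝ᵥ ((star C * C) *ᵥ b) =
      inner ℂ (WithLp.toLp 2 (C *ᵥ a)) (WithLp.toLp 2 (C *ᵥ b)) := by
    intro a b
    rw [← Matrix.mulVec_mulVec, Matrix.dotProduct_mulVec, EuclideanSpace.inner_toLp_toLp,
      Matrix.star_mulVec, dotProduct_comm]
    rfl
  rw [h, h, h]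
  have h2 : ∀ u : EuclideanSpace ℂ S, (inner ℂ u u).re = ‖u‖ ^ 2 := fun u => by
    rw [inner_self_eq_norm_sq_to_K]
    norm_cast
  rw [h2, h2, ← mul_pow]
  exact pow_le_pow_left₀ (norm_nonneg _) (norm_inner_le_norm _ _) 2

variable [DecidableEq S]

/-- The Hermitian matrix `V - |φ⟩⟨φ|` squares to `V` times itself, so for `V > 0` it is a positive
multiple of a Gram matrix. -/
theorem smul_one_sub_ketbra_posSemidef {φ : S → ℂ} {V : ℝ} (h : star φ ⬝ᵥ φ = V) :
    ((V : ℂ) • (1 : Matrix S S ℂ) - ketbra φ).PosSemidef := by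
  have hV : 0 ≤ V := by
    have := dotProduct_star_self_nonneg φ
    rw [h] at this
    exact_mod_cast this
  have hN : ketbra φ * ketbra φ = (V : ℂ) • ketbra φ := by
    rw [ketbra, Matrix.vecMulVec_mul_vecMulVec, h, Matrix.vecMulVec_smul]
  have hH : ((V : ℂ) • (1 : Matrix S S ℂ) - ketbra φ).IsHermitian := by
    rw [Matrix.IsHermitian, Matrix.conjTranspose_sub, Matrix.conjTranspose_smul,
      Matrix.conjTranspose_one, (ketbra_isHermitian φ).eq]
    simp
  rcases hV.eq_or_lt with h0 | hpos
  · rw [← h0, Complex.ofReal_zero] at h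
    have hz : φ = 0 := dotProduct_star_self_eq_zero.mp h
    subst hz
    rw [← h0]
    simpa [ketbra] using Matrix.PosSemidef.zero
  · have h1 := Matrix.posSemidef_conjTranspose_mul_self ((V : ℂ) • (1 : Matrix S S ℂ) - ketbra φ)
    have h2 : ((V : ℂ) • (1 : Matrix S S ℂ) - ketbra φ)ᴴ * ((V : ℂ) • (1 : Matrix S S ℂ) - ketbra φ)
        = (V : ℂ) • ((V : ℂ) • (1 : Matrix S S ℂ) - ketbra φ) := by
      rw [hH.eq, sub_mul, mul_sub, mul_sub, hN]
      simp only [smul_mul_assoc, mul_smul_comm, one_mul, mul_one]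
      module
    rw [h2] at h1
    have h3 := h1.smul (a := ((V⁻¹ : ℝ) : ℂ)) (by exact_mod_cast (inv_pos.mpr hpos).le)
    rwa [smul_smul, ← Complex.ofReal_mul, inv_mul_cancel₀ hpos.ne', Complex.ofReal_one,
      one_smul] at h3

/-- The variance of the observable `H` in the state `ψ`. -/
def variance (ψ : S → ℂ) (H : Matrix S S ℂ) : ℝ :=
  prob (ketbra ψ) (H * H) - prob (ketbra ψ) H ^ 2

/-- The velocity `-i[H, |ψ⟩⟨ψ|]` of a pure state that evolves under `H`. -/
def velocity (ψ : S → ℂ) (H : Matrix S S ℂ) : Matrix S S ℂ :=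
  -Complex.I • (H * ketbra ψ - ketbra ψ * H)

omit [DecidableEq S] in
theorem velocity_isHermitian (ψ : S → ℂ) {H : Matrix S S ℂ} (hH : H.IsHermitian) :
    (velocity ψ H).IsHermitian := by
  rw [Matrix.IsHermitian, velocity, Matrix.conjTranspose_smul, Matrix.conjTranspose_sub,
    Matrix.conjTranspose_mul, Matrix.conjTranspose_mul, hH.eq, (ketbra_isHermitian ψ).eq]
  simp only [star_neg, RCLike.star_def, Complex.conj_I, neg_neg, neg_smul]
  rw [← smul_neg, neg_sub]

omit [DecidableEq S] in
theorem trace_velocity (ψ : S → ℂ) (H : Matrix S S ℂ) : (velocity ψ H).trace = 0 := by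
  rw [velocity, Matrix.trace_smul, Matrix.trace_sub, Matrix.trace_mul_comm, sub_self, smul_zero]

omit [DecidableEq S] in
-- Take `φ = (H - ⟨H⟩) ψ`. Subtracting the scalar `⟨H⟩` does not change the commutator, makes `φ`
-- orthogonal to `ψ`, and turns its squared norm into the variance.
theorem exists_velocity_eq {ψ : S → ℂ} (hψ : IsKet ψ) {H : Matrix S S ℂ} (hH : H.IsHermitian) :
    ∃ φ : S → ℂ, star φ ⬝ᵥ φ = (variance ψ H : ℂ) ∧ star ψ ⬝ᵥ φ = 0 ∧ star φ ⬝ᵥ ψ = 0 ∧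
      velocity ψ H =
        -Complex.I • (Matrix.vecMulVec φ (star ψ) - Matrix.vecMulVec ψ (star φ)) := by
  have hψ' : star ψ ⬝ᵥ ψ = 1 := hψ
  have hHψ : star ψ ⬝ᵥ (H *ᵥ ψ) = (prob (ketbra ψ) H : ℂ) := by
    rw [← trace_mul_ketbra, trace_mul_of_isHermitian hH (ketbra_isHermitian ψ), prob_comm]
  have hHH : (H * H).IsHermitian := by
    rw [Matrix.IsHermitian, Matrix.conjTranspose_mul, hH.eq]
  have hHHψ : star ψ ⬝ᵥ ((H * H) *ᵥ ψ) = (prob (ketbra ψ) (H * H) : ℂ) := by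
    rw [← trace_mul_ketbra, trace_mul_of_isHermitian hHH (ketbra_isHermitian ψ), prob_comm]
  have hs : star (H *ᵥ ψ) = star ψ ᵥ* H := by rw [Matrix.star_mulVec, hH.eq]
  have hc : star (H *ᵥ ψ) ⬝ᵥ ψ = (prob (ketbra ψ) H : ℂ) := by
    rw [hs, ← Matrix.dotProduct_mulVec, hHψ]
  set h := prob (ketbra ψ) H with hh
  have hstar : star (H *ᵥ ψ - (h : ℂ) • ψ) = star ψ ᵥ* H - (h : ℂ) • star ψ := by
    rw [star_sub, star_smul, hs]
    simp
  refine ⟨H *ᵥ ψ - (h : ℂ) • ψ, ?_, ?_, ?_, ?_⟩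
  · rw [hstar, sub_dotProduct, dotProduct_sub, dotProduct_sub, ← hs, hs, dotProduct_smul,
      smul_dotProduct, smul_dotProduct, dotProduct_smul, ← Matrix.dotProduct_mulVec,
      Matrix.mulVec_mulVec, hHHψ, hHψ, ← Matrix.dotProduct_mulVec, hHψ, hψ', variance]
    simp only [smul_eq_mul]
    push_cast
    ring
  · rw [dotProduct_sub, dotProduct_smul, hHψ, hψ']
    simp
  · rw [hstar, sub_dotProduct, smul_dotProduct, ← hs, hc, hψ']
    simp
  · rw [hstar, velocity, ketbra, Matrix.mul_vecMulVec, Matrix.vecMulVec_mul,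
      Matrix.sub_vecMulVec, Matrix.vecMulVec_sub, Matrix.vecMulVec_smul, Matrix.smul_vecMulVec]
    congr 1
    abel

/-- Since `φ ⟂ ψ`, the square of the velocity is `|φ⟩⟨φ| + V |ψ⟩⟨ψ|`, which is `V` times the
projection onto the span of `φ` and `ψ`. -/
theorem velocity_mul_self {ψ : S → ℂ} (hψ : IsKet ψ) {H : Matrix S S ℂ} (hH : H.IsHermitian) :
    prob (velocity ψ H) (velocity ψ H) = 2 * variance ψ H ∧
    ((variance ψ H : ℂ) • (1 : Matrix S S ℂ) - velocity ψ H * velocity ψ H).PosSemidef := by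
  obtain ⟨φ, h1, h2, h3, h4⟩ := exists_velocity_eq hψ hH
  have hψ' : star ψ ⬝ᵥ ψ = 1 := hψ
  have hsq : velocity ψ H * velocity ψ H = ketbra φ + (variance ψ H : ℂ) • ketbra ψ := by
    have hI : -Complex.I * -Complex.I = -1 := by simp
    rw [h4, smul_mul_smul_comm, hI, ketbra, ketbra]
    simp only [sub_mul, mul_sub, Matrix.vecMulVec_mul_vecMulVec,
      h1, h2, h3, hψ', zero_smul, one_smul, Matrix.vecMulVec_zero, Matrix.vecMulVec_smul]
    module
  constructor
  · rw [prob, hsq, Matrix.trace_add, Matrix.trace_smul, hψ.trace_ketbra, ketbra,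
      Matrix.trace_vecMulVec, dotProduct_comm, h1]
    simp
    ring
  · have hP : (1 - ketbra ψ)ᴴ = 1 - ketbra ψ := by
      rw [Matrix.conjTranspose_sub, Matrix.conjTranspose_one, (ketbra_isHermitian ψ).eq]
    -- Compressing `V - |φ⟩⟨φ|` to the complement of `ψ` gives exactly `V - |φ⟩⟨φ| - V |ψ⟩⟨ψ|`.
    have h5 := (smul_one_sub_ketbra_posSemidef h1).conjTranspose_mul_mul_same (1 - ketbra ψ)
    convert h5 using 1
    rw [hP, hsq]
    have e1 : ketbra ψ * ketbra φ = 0 := by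
      rw [ketbra, ketbra, Matrix.vecMulVec_mul_vecMulVec, h2]; simp
    have e2 : ketbra φ * ketbra ψ = 0 := by
      rw [ketbra, ketbra, Matrix.vecMulVec_mul_vecMulVec, h3]; simp
    have e3 : ketbra ψ * ketbra ψ = ketbra ψ := by
      rw [ketbra, Matrix.vecMulVec_mul_vecMulVec, hψ']; simp
    simp only [sub_mul, mul_sub, one_mul, mul_one, smul_mul_assoc, mul_smul_comm, e1, e2, e3, zero_mul]
    module

end Prob

/-! ### Noise by Hermitian involutions -/

section Noise

variable {S m : Type*} [Fintype S] [Fintype m]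

/-- The channel that applies the unitary `Q k` with probability `qs k`. -/
def noiseMap (Q : m → Matrix S S ℂ) (qs : m → ℝ) (Z : Matrix S S ℂ) : Matrix S S ℂ :=
  ((1 - ∑ k, qs k : ℝ) : ℂ) • Z + ∑ k, (qs k : ℂ) • (Q k * Z * Q k)

theorem noiseMap_add (Q : m → Matrix S S ℂ) (qs : m → ℝ) (Z Z' : Matrix S S ℂ) :
    noiseMap Q qs (Z + Z') = noiseMap Q qs Z + noiseMap Q qs Z' := by
  simp only [noiseMap, mul_add, add_mul, smul_add, Finset.sum_add_distrib]
  abel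

theorem noiseMap_smul (Q : m → Matrix S S ℂ) (qs : m → ℝ) (c : ℂ) (Z : Matrix S S ℂ) :
    noiseMap Q qs (c • Z) = c • noiseMap Q qs Z := by
  simp only [noiseMap, mul_smul_comm, smul_mul_assoc, smul_add, Finset.smul_sum, smul_comm _ c]

theorem noiseMap_zero_rates (Q : m → Matrix S S ℂ) (Z : Matrix S S ℂ) :
    noiseMap Q 0 Z = Z := by
  simp [noiseMap]

/-- `noiseMap` followed by the Born probability of `E`, as a real linear functional. -/
def noiseProb (Q : m → Matrix S S ℂ) (qs : m → ℝ) (E : Matrix S S ℂ) : Matrix S S ℂ →ₗ[ℝ] ℝ where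
  toFun Z := prob (noiseMap Q qs Z) E
  map_add' Z Z' := by rw [noiseMap_add, prob_add]
  map_smul' c Z := by
    rw [← Complex.coe_smul, noiseMap_smul, prob_smul]
    rfl

theorem prob_noiseMap (Q : m → Matrix S S ℂ) (qs : m → ℝ) (Z E : Matrix S S ℂ) :
    prob (noiseMap Q qs Z) E =
      (1 - ∑ k, qs k) * prob Z E + ∑ k, qs k * prob (Q k * Z * Q k) E := by
  rw [noiseMap, prob_add, prob_smul, prob_sum]
  simp only [prob_smul]

variable {Q : m → Matrix S S ℂ} {qs : m → ℝ}

theorem noiseMap_isHermitian (hQ : ∀ k, (Q k).IsHermitian) {Z : Matrix S S ℂ}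
    (hZ : Z.IsHermitian) : (noiseMap Q qs Z).IsHermitian := by
  rw [Matrix.IsHermitian, noiseMap, Matrix.conjTranspose_add, Matrix.conjTranspose_smul, hZ.eq,
    Matrix.conjTranspose_sum]
  simp only [Matrix.conjTranspose_smul, Matrix.conjTranspose_mul, hZ.eq, (hQ _).eq,
    RCLike.star_def, Complex.conj_ofReal, Matrix.mul_assoc]

theorem noiseMap_posSemidef (hQ : ∀ k, (Q k).IsHermitian) (hqs : ∀ k, 0 ≤ qs k)
    (hq : ∑ k, qs k ≤ 1) {Z : Matrix S S ℂ} (hZ : Z.PosSemidef) :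
    (noiseMap Q qs Z).PosSemidef := by
  refine (hZ.smul (by exact_mod_cast sub_nonneg.mpr hq)).add
    (Matrix.posSemidef_sum _ fun k _ => ?_)
  have h := hZ.mul_mul_conjTranspose_same (Q k)
  rw [(hQ k).eq] at h
  exact h.smul (by exact_mod_cast hqs k)

variable [DecidableEq S]

theorem trace_noiseMap (hQ2 : ∀ k, Q k * Q k = 1) (Z : Matrix S S ℂ) :
    (noiseMap Q qs Z).trace = Z.trace := by
  have h : ∀ k, (Q k * Z * Q k).trace = Z.trace := fun k => by
    rw [Matrix.trace_mul_comm, ← Matrix.mul_assoc, hQ2, Matrix.one_mul]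
  simp only [noiseMap, Matrix.trace_add, Matrix.trace_smul, Matrix.trace_sum, h, smul_eq_mul,
    ← Finset.sum_mul]
  push_cast
  ring

/-- Conjugation by `Q k` preserves `Tr(Y²)`, so `Tr((Y + Q k Y Q k)²) ≥ 0` bounds each error term
below by `-Tr(Y²)`. With total weight `q` on these terms, `(1 - q) - q` remains. -/
theorem prob_noiseMap_self_ge (hQ : ∀ k, (Q k).IsHermitian) (hQ2 : ∀ k, Q k * Q k = 1)
    (hqs : ∀ k, 0 ≤ qs k) {Y : Matrix S S ℂ} (hY : Y.IsHermitian) :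
    (1 - 2 * ∑ k, qs k) * prob Y Y ≤ prob (noiseMap Q qs Y) Y := by
  have h : ∀ k, -prob Y Y ≤ prob (Q k * Y * Q k) Y := by
    intro k
    have hH : (Y + Q k * Y * Q k)ᴴ = Y + Q k * Y * Q k := by
      rw [Matrix.conjTranspose_add, Matrix.conjTranspose_mul, Matrix.conjTranspose_mul, hY.eq,
        (hQ k).eq, Matrix.mul_assoc]
    have h1 := (Matrix.posSemidef_conjTranspose_mul_self (Y + Q k * Y * Q k)).trace_nonneg
    rw [hH] at h1
    have h2 : 0 ≤ prob (Y + Q k * Y * Q k) (Y + Q k * Y * Q k) := (Complex.le_def.mp h1).1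
    have h3 : prob (Q k * Y * Q k) (Q k * Y * Q k) = prob Y Y := by
      have : Q k * Y * Q k * (Q k * Y * Q k) = Q k * (Y * Y * Q k) := by
        calc _ = Q k * Y * (Q k * Q k) * (Y * Q k) := by simp only [Matrix.mul_assoc]
          _ = _ := by rw [hQ2, Matrix.mul_one]; simp only [Matrix.mul_assoc]
      rw [prob, this, Matrix.trace_mul_comm, Matrix.mul_assoc, hQ2, Matrix.mul_one, prob]
    rw [prob_add, prob_comm Y, prob_add, prob_comm (Q k * Y * Q k) (_ + _), prob_add, h3,
      prob_comm Y (Q k * Y * Q k)] at h2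
    linarith
  rw [prob_noiseMap]
  have h4 : ∑ k, qs k * -prob Y Y ≤ ∑ k, qs k * prob (Q k * Y * Q k) Y :=
    Finset.sum_le_sum fun k _ => mul_le_mul_of_nonneg_left (h k) (hqs k)
  rw [← Finset.sum_mul] at h4
  linarith

end Noise

/-! ### Derivatives of outcome probabilities and the Fisher quadratic form -/

section Fisher

variable {S m : Type*} [Fintype S] [DecidableEq m]

/-- `W θ` is a smooth family of operators with `∂_j W = -i Q_j` at `θ = 0`. -/
structure IsGeneratedBy [DecidableEq S] (W : (m → ℝ) → Matrix S S ℂ) (Q : m → Matrix S S ℂ) :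
    Prop where
  map_zero : W 0 = 1
  hasDerivAt : ∀ j a b,
    HasDerivAt (fun t : ℝ => W (t • Pi.single j 1) a b) ((-Complex.I • Q j) a b) 0

open scoped Matrix.Norms.Operator in
theorem IsGeneratedBy.partialDeriv_eq [DecidableEq S] [Fintype m]
    {W : (m → ℝ) → Matrix S S ℂ} {Q : m → Matrix S S ℂ} (h : IsGeneratedBy W Q)
    (hQ : ∀ k, (Q k).IsHermitian) (qs : m → ℝ) (ψ : S → ℂ) (E : Matrix S S ℂ) (j : m) :
    partialDeriv (fun t => prob (noiseMap Q qs (W t * ketbra ψ * (W t)ᴴ)) E) 0 j =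
      prob (noiseMap Q qs (velocity ψ (Q j))) E := by
  have h1 : HasDerivAt (fun t : ℝ => W (t • Pi.single j 1)) (-Complex.I • Q j) 0 := 
    hasDerivAt_pi.mpr fun a => hasDerivAt_pi.mpr fun b => h.hasDerivAt j a b
  have h1' : HasDerivAt (fun t : ℝ => (W (t • Pi.single j 1))ᴴ) (-Complex.I • Q j)ᴴ 0 :=
    hasDerivAt_pi.mpr fun a => hasDerivAt_pi.mpr fun b => (h.hasDerivAt j b a).star
  have h2 := (h1.mul_const (ketbra ψ)).mul h1'
  have h3 := ((noiseProb Q qs E).toContinuousLinearMap.hasFDerivAt).comp_hasDerivAt (0 : ℝ) h2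
  rw [partialDeriv, lineDeriv]
  simp only [zero_add]
  refine (HasDerivAt.deriv h3).trans ?_
  change prob (noiseMap Q qs _) E = _
  congr 2
  simp only [zero_smul, h.map_zero, Matrix.conjTranspose_one, mul_one, one_mul,
    Matrix.conjTranspose_smul, (hQ j).eq, velocity, star_neg, RCLike.star_def, Complex.conj_I,
    neg_neg]
  rw [smul_mul_assoc, mul_smul_comm]
  module

/-- A zero of a nonnegative function is a minimum. For outcome probabilities this shows that the
outcomes with `p_x = 0`, left out of the Fisher sum, have zero derivative, so that lower bounds may
still be summed over all outcomes. -/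
theorem partialDeriv_eq_zero_of_nonneg {f : (m → ℝ) → ℝ} (hf : ∀ t, 0 ≤ f t) {θ : m → ℝ}
    (h0 : f θ = 0) (j : m) : partialDeriv f θ j = 0 := by
  rw [partialDeriv, lineDeriv]
  apply IsLocalMin.deriv_eq_zero
  refine Filter.Eventually.of_forall fun t => ?_
  simpa [h0] using hf _

theorem cfim_quadratic_form [Fintype m] {X : Type*} [Fintype X] (ρ : (m → ℝ) → Matrix S S ℂ)
    (M : X → Matrix S S ℂ) (θ c : m → ℝ) :
    c ⬝ᵥ (cfim ρ M θ *ᵥ c) = ∑ x, if prob (ρ θ) (M x) = 0 then 0 else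
      1 / prob (ρ θ) (M x) * (∑ j, c j * partialDeriv (fun t => prob (ρ t) (M x)) θ j) ^ 2 := by
  simp only [dotProduct, Matrix.mulVec, cfim, Matrix.of_apply, tsum_fintype, Finset.sum_mul,
    Finset.mul_sum]
  have : ∀ i, (∑ j, ∑ x, c i * ((if prob (ρ θ) (M x) = 0 then 0 else 1 / prob (ρ θ) (M x) *
        (partialDeriv (fun t => prob (ρ t) (M x)) θ i *
          partialDeriv (fun t => prob (ρ t) (M x)) θ j)) * c j)) =
      ∑ x, ∑ j, c i * ((if prob (ρ θ) (M x) = 0 then 0 else 1 / prob (ρ θ) (M x) *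
        (partialDeriv (fun t => prob (ρ t) (M x)) θ i *
          partialDeriv (fun t => prob (ρ t) (M x)) θ j)) * c j) := fun i => Finset.sum_comm
  simp only [this]
  rw [Finset.sum_comm]
  refine Finset.sum_congr rfl fun x _ => ?_
  split_ifs with h
  · simp
  · rw [sq, Finset.sum_mul_sum, Finset.mul_sum]
    refine Finset.sum_congr rfl fun i _ => ?_
    rw [Finset.mul_sum]
    exact Finset.sum_congr rfl fun j _ => by ring

end Fisher

/-! ### Lower bound for 3-design measurements under noise -/

section FisherBounds

variable {S m : Type*} [Fintype S] [DecidableEq S] [Fintype m] [DecidableEq m]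

theorem ketbra_posSemidef {S : Type*} [Fintype S] (ψ : S → ℂ) : (ketbra ψ).PosSemidef :=
  Matrix.posSemidef_vecMulVec_self_star ψ

omit [DecidableEq S] [DecidableEq m] in
theorem sum_smul_velocity (ψ : S → ℂ) (Q : m → Matrix S S ℂ) (c : m → ℝ) :
    ∑ j, (c j : ℂ) • velocity ψ (Q j) = velocity ψ (∑ j, (c j : ℂ) • Q j) := by
  simp only [velocity, Finset.sum_mul, Finset.mul_sum, smul_mul_assoc, mul_smul_comm,
    ← Finset.sum_sub_distrib, Finset.smul_sum, ← smul_sub, smul_comm (-Complex.I)]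

omit [DecidableEq S] [DecidableEq m] in
theorem noiseMap_sum_smul (Q : m → Matrix S S ℂ) (qs : m → ℝ) (c : m → ℝ)
    (Z : m → Matrix S S ℂ) :
    noiseMap Q qs (∑ j, (c j : ℂ) • Z j) = ∑ j, (c j : ℂ) • noiseMap Q qs (Z j) := by
  have h := map_sum (⟨⟨noiseMap Q qs, noiseMap_add Q qs⟩, noiseMap_smul Q qs⟩ :
    Matrix S S ℂ →ₗ[ℂ] Matrix S S ℂ) (fun j => (c j : ℂ) • Z j) Finset.univ
  refine h.trans (Finset.sum_congr rfl fun j _ => noiseMap_smul Q qs _ _)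

/-- This is `(A - g p)² ≥ 0` divided by `p`. It replaces the rational function `A² / p` by a
polynomial whose sum is a design moment. -/
theorem le_sq_div {p A g : ℝ} (hp : 0 ≤ p) (h : p = 0 → A = 0) [Decidable (p = 0)] :
    2 * A * g - g ^ 2 * p ≤ if p = 0 then 0 else 1 / p * A ^ 2 := by
  split_ifs with h0
  · rw [h h0, h0]; simp
  · have hp' : 0 < p := lt_of_le_of_ne hp (Ne.symm h0)
    have : 1 / p * A ^ 2 - (2 * A * g - g ^ 2 * p) = (A - g * p) ^ 2 / p := by
      field_simp
      ring
    have h2 : 0 ≤ (A - g * p) ^ 2 / p := by positivity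
    linarith

variable {Q : m → Matrix S S ℂ} {qs : m → ℝ} {W : (m → ℝ) → Matrix S S ℂ}

/-- Under the noise, the Fisher information about the parameter direction `c` that a 3-design
measurement extracts from a pure input state is at least a multiple of the variance of the
generator of this direction. -/
theorem IsThreeDesign.le_cfim_noiseMap [Nonempty S] {ι : Type*} [Fintype ι] {w : ι → ℝ}
    {v : ι → S → ℂ} (hd : IsThreeDesign w v) (hW : IsGeneratedBy W Q)
    (hQ : ∀ k, (Q k).IsHermitian) (hQ2 : ∀ k, Q k * Q k = 1) (hqs : ∀ k, 0 ≤ qs k)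
    (hq : ∑ k, qs k < 1 / 2) {ψ : S → ℂ} (hψ : IsKet ψ) (c : m → ℝ) :
    (1 - 2 * ∑ k, qs k) ^ 2 * (((Fintype.card S : ℝ) + 2) / (Fintype.card S + 1)) *
      variance ψ (∑ j, (c j : ℂ) • Q j) ≤
    c ⬝ᵥ (cfim (fun θ => noiseMap Q qs (W θ * ketbra ψ * (W θ)ᴴ)) (designPOVM w v) 0 *ᵥ c) := by
  set q := ∑ k, qs k with hq_def
  set H := ∑ j, (c j : ℂ) • Q j with hH_def
  set V := variance ψ H with hV
  set Y := velocity ψ H with hY_def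
  set R := noiseMap Q qs (ketbra ψ) with hR_def
  set D : ℝ := (Fintype.card S : ℝ) with hD
  have hDpos : 0 < D := by
    rw [hD]; exact_mod_cast Fintype.card_pos
  have hHh : H.IsHermitian := by
    rw [Matrix.IsHermitian, hH_def, Matrix.conjTranspose_sum]
    simp only [Matrix.conjTranspose_smul, (hQ _).eq, RCLike.star_def, Complex.conj_ofReal]
  have hYh := velocity_isHermitian ψ hHh
  have hXh := noiseMap_isHermitian (qs := qs) hQ hYh
  have hRpsd : R.PosSemidef := noiseMap_posSemidef hQ hqs (by linarith) (ketbra_posSemidef ψ)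
  have hR0 : noiseMap Q qs (W 0 * ketbra ψ * (W 0)ᴴ) = R := by
    rw [hW.map_zero, Matrix.conjTranspose_one, Matrix.one_mul, Matrix.mul_one]
  have hRt : R.trace = 1 := by rw [hR_def, trace_noiseMap hQ2, hψ.trace_ketbra]
  obtain ⟨hYY, hYY2⟩ := velocity_mul_self hψ hHh
  have hM : ∀ s, (designPOVM w v s).PosSemidef := fun s =>
    (ketbra_posSemidef (v s)).smul (by
      exact_mod_cast mul_nonneg (hd.pos s).le (Nat.cast_nonneg (α := ℝ) (Fintype.card S)))
  have hprobM : ∀ (Z : Matrix S S ℂ) s, prob Z (designPOVM w v s) =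
      w s * D * prob Z (ketbra (v s)) := by
    intro Z s
    rw [prob_comm, designPOVM, prob_comm Z, ← prob_smul]
    congr 2
    rw [hD]
    push_cast
    rfl
  have hpos : ∀ s t, 0 ≤ prob (noiseMap Q qs (W t * ketbra ψ * (W t)ᴴ)) (designPOVM w v s) :=
    fun s t => prob_nonneg (noiseMap_posSemidef hQ hqs (by linarith)
      ((ketbra_posSemidef ψ).mul_mul_conjTranspose_same _)) (hM s)
  have hlin : ∀ s, ∑ j, c j * partialDeriv
      (fun t => prob (noiseMap Q qs (W t * ketbra ψ * (W t)ᴴ)) (designPOVM w v s)) 0 j =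
      w s * D * prob (noiseMap Q qs Y) (ketbra (v s)) := by
    intro s
    rw [← hprobM, hY_def, hH_def, ← sum_smul_velocity, noiseMap_sum_smul, prob_sum]
    exact Finset.sum_congr rfl fun j _ => by rw [prob_smul, hW.partialDeriv_eq hQ]
  have hzero : ∀ s, prob R (designPOVM w v s) = 0 →
      w s * D * prob (noiseMap Q qs Y) (ketbra (v s)) = 0 := by
    intro s hs
    rw [← hlin]
    refine Finset.sum_eq_zero fun j _ => ?_
    rw [partialDeriv_eq_zero_of_nonneg (hpos s) (by rw [hR0]; exact hs), mul_zero]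
  rw [cfim_quadratic_form]
  simp only [hlin, hR0]
  -- This `l` maximizes the final bound `4 l (1 - 2q) V / (D + 1) - 4 l² V / ((D + 1)(D + 2))`.
  set l : ℝ := (1 - 2 * q) * (D + 2) / 2 with hl
  -- The test value uses the noiseless velocity `Y`: the cross term becomes `Tr(XY)`, and the square
  -- involves `Y²`, whose bound by `V` is independent of the noise.
  have hterm := fun s => le_sq_div (g := l * prob Y (ketbra (v s))) (prob_nonneg hRpsd (hM s))
    (hzero s)
  refine le_trans ?_ (Finset.sum_le_sum fun s _ => hterm s)
  have hX0 : (noiseMap Q qs Y).trace = 0 := by rw [trace_noiseMap hQ2, trace_velocity]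
  have hm2 := hd.sum_prob_mul_prob hXh hYh hX0 (trace_velocity ψ H)
  have hm3 := hd.sum_prob_sq_mul_prob hYh hRpsd.1 (trace_velocity ψ H) hRt
  have hsum : ∑ s, (2 * (w s * D * prob (noiseMap Q qs Y) (ketbra (v s))) *
      (l * prob Y (ketbra (v s))) -
      (l * prob Y (ketbra (v s))) ^ 2 * prob R (designPOVM w v s)) =
      2 * l * D * (prob (noiseMap Q qs Y) Y / (D * (D + 1))) -
      l ^ 2 * D * ((prob Y Y + 2 * prob (Y * Y) R) / (D * (D + 1) * (D + 2))) := by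
    rw [← hm2, ← hm3, Finset.mul_sum, Finset.mul_sum, ← Finset.sum_sub_distrib]
    refine Finset.sum_congr rfl fun s _ => ?_
    rw [hprobM]
    ring
  rw [hsum]
  have hA : (1 - 2 * q) * (2 * V) ≤ prob (noiseMap Q qs Y) Y := by
    rw [hV, ← hYY]
    exact prob_noiseMap_self_ge hQ hQ2 hqs hYh
  have hB : prob (Y * Y) R ≤ V := by
    have h1 := prob_nonneg hYY2 hRpsd
    rw [prob_sub, prob_smul] at h1
    have h2 : prob (1 : Matrix S S ℂ) R = 1 := by rw [prob, Matrix.one_mul, hRt]; simp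
    rw [h2] at h1
    linarith
  have hl0 : 0 ≤ l := by
    rw [hl]
    have : 0 ≤ 1 - 2 * q := by linarith
    positivity
  calc (1 - 2 * q) ^ 2 * ((D + 2) / (D + 1)) * V
      = 2 * l * D * ((1 - 2 * q) * (2 * V) / (D * (D + 1))) -
        l ^ 2 * D * ((2 * V + 2 * V) / (D * (D + 1) * (D + 2))) := by
        rw [hl]; field_simp; ring
    _ ≤ _ := by
        rw [hYY]
        gcongr

end FisherBounds

/-! ### Upper bound on noiseless Fisher information -/

section Ideal

variable {S m : Type*} [Fintype S] [DecidableEq S] [Fintype m] [DecidableEq m]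

/-- The derivative of the probability of an outcome is bounded by the geometric mean of two
outcome probabilities. -/
theorem sq_prob_velocity_le {ψ : S → ℂ} {H M : Matrix S S ℂ} (hH : H.IsHermitian)
    (hM : M.PosSemidef) :
    prob (velocity ψ H) M ^ 2 ≤ 4 * prob (ketbra ψ) M * prob (H * ketbra ψ * H) M := by
  have h1 := norm_sq_dotProduct_mulVec_le hM ψ (H *ᵥ ψ)
  have h2 : (star ψ ⬝ᵥ (M *ᵥ ψ)).re = prob (ketbra ψ) M := by
    rw [← trace_mul_ketbra, prob_comm, prob]
  have h3 : (star (H *ᵥ ψ) ⬝ᵥ (M *ᵥ (H *ᵥ ψ))).re = prob (H * ketbra ψ * H) M := by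
    rw [← trace_mul_ketbra, ketbra, Matrix.star_mulVec, hH.eq, ← Matrix.mul_vecMulVec,
      ← Matrix.vecMulVec_mul, prob_comm]
    simp only [prob, ketbra, Matrix.mul_assoc]
  have h4 : prob (velocity ψ H) M = 2 * (star ψ ⬝ᵥ (M *ᵥ (H *ᵥ ψ))).im := by
    have e1 : (H * ketbra ψ * M).trace = star ψ ⬝ᵥ (M *ᵥ (H *ᵥ ψ)) := by
      rw [Matrix.mulVec_mulVec, ← trace_mul_ketbra, Matrix.trace_mul_comm, Matrix.mul_assoc]
    have e2 : (ketbra ψ * H * M).trace = star (star ψ ⬝ᵥ (M *ᵥ (H *ᵥ ψ))) := by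
      rw [← e1, ← Matrix.trace_conjTranspose, Matrix.conjTranspose_mul, Matrix.conjTranspose_mul,
        hM.1.eq, hH.eq, (ketbra_isHermitian ψ).eq, Matrix.trace_mul_comm]
    rw [prob, velocity, smul_mul_assoc, Matrix.trace_smul, sub_mul, Matrix.trace_sub, e1, e2]
    simp
    ring
  rw [h2, h3] at h1
  have h5 : (star ψ ⬝ᵥ (M *ᵥ (H *ᵥ ψ))).im ^ 2 ≤ ‖star ψ ⬝ᵥ (M *ᵥ (H *ᵥ ψ))‖ ^ 2 := by
    rw [← sq_abs]
    exact pow_le_pow_left₀ (abs_nonneg _) (Complex.abs_im_le_norm _) 2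
  rw [h4]
  nlinarith

/-- The diagonal entries of the noiseless Fisher information matrix are at most `4` when the
generators square to the identity. -/
theorem cfim_diag_le_four {X : Type*} {W : (m → ℝ) → Matrix S S ℂ} {Q : m → Matrix S S ℂ}
    (hW : IsGeneratedBy W Q) (hQ : ∀ k, (Q k).IsHermitian) (hQ2 : ∀ k, Q k * Q k = 1)
    {ψ : S → ℂ} (hψ : IsKet ψ) {M : X → Matrix S S ℂ} (hM : IsPOVM M) (j : m) :
    0 ≤ cfim (fun θ => W θ * ketbra ψ * (W θ)ᴴ) M 0 j j ∧
      cfim (fun θ => W θ * ketbra ψ * (W θ)ᴴ) M 0 j j ≤ 4 := by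
  have hder : ∀ x, partialDeriv (fun t => prob (W t * ketbra ψ * (W t)ᴴ) (M x)) 0 j =
      prob (velocity ψ (Q j)) (M x) := fun x => by
    have := hW.partialDeriv_eq hQ 0 ψ (M x) j
    simpa only [noiseMap_zero_rates] using this
  have h0 : W 0 * ketbra ψ * (W 0)ᴴ = ketbra ψ := by
    rw [hW.map_zero, Matrix.conjTranspose_one, Matrix.one_mul, Matrix.mul_one]
  simp only [cfim, Matrix.of_apply, hder, h0]
  have hnn : ∀ x, 0 ≤ if prob (ketbra ψ) (M x) = 0 then 0 else 1 / prob (ketbra ψ) (M x) *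
      (prob (velocity ψ (Q j)) (M x) * prob (velocity ψ (Q j)) (M x)) := by
    intro x
    have := prob_nonneg (ketbra_posSemidef ψ) (hM.posSemidef x)
    split_ifs
    · exact le_rfl
    · exact mul_nonneg (by positivity) (mul_self_nonneg _)
  have hpsd : (Q j * ketbra ψ * Q j).PosSemidef := by
    have := (ketbra_posSemidef ψ).mul_mul_conjTranspose_same (Q j)
    rwa [(hQ j).eq] at this
  -- After division by `p_x`, Cauchy-Schwarz leaves four times the probability of `x` in the state
  -- `Q j ψ`; these sum to `4` because `M` is a POVM and `Q j` is unitary.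
  have hle : ∀ x, (if prob (ketbra ψ) (M x) = 0 then 0 else 1 / prob (ketbra ψ) (M x) *
      (prob (velocity ψ (Q j)) (M x) * prob (velocity ψ (Q j)) (M x))) ≤
      4 * prob (Q j * ketbra ψ * Q j) (M x) := by
    intro x
    have h1 := prob_nonneg (ketbra_posSemidef ψ) (hM.posSemidef x)
    have h2 := prob_nonneg hpsd (hM.posSemidef x)
    split_ifs with h
    · positivity
    · have h3 : 0 < prob (ketbra ψ) (M x) := lt_of_le_of_ne h1 (Ne.symm h)
      rw [one_div, inv_mul_le_iff₀ h3, ← sq]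
      have := sq_prob_velocity_le (ψ := ψ) (hQ j) (hM.posSemidef x)
      linarith
  have hcont : Continuous fun E : Matrix S S ℂ => prob (Q j * ketbra ψ * Q j) E := by
    unfold prob
    fun_prop
  have hsum : HasSum (fun x => 4 * prob (Q j * ketbra ψ * Q j) (M x)) 4 := by
    have h1 := hM.hasSum_one.map (AddMonoidHom.mk' (fun E => prob (Q j * ketbra ψ * Q j) E)
      fun a b => by rw [prob_comm, prob_add, prob_comm a, prob_comm b]) hcont
    have h2 : prob (Q j * ketbra ψ * Q j) 1 = 1 := by
      rw [prob, Matrix.mul_one, Matrix.trace_mul_comm, ← Matrix.mul_assoc, hQ2, Matrix.one_mul,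
        hψ.trace_ketbra, Complex.one_re]
    have h3 := h1.mul_left 4
    simp only [Function.comp_def, AddMonoidHom.mk'_apply, h2, mul_one] at h3
    exact h3
  exact ⟨tsum_nonneg hnn, (Summable.tsum_le_tsum hle (hsum.summable.of_nonneg_of_le hnn hle)
    hsum.summable).trans hsum.tsum_eq.le⟩

end Ideal

/-! ### Traces of inverses -/

section TraceInv

variable {m : Type*} [Fintype m] [DecidableEq m]

/-- The trace of the product of positive semidefinite real matrices. -/
theorem trace_mul_nonneg {A B : Matrix m m ℝ} (hA : A.PosSemidef) (hB : B.PosSemidef) :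
    0 ≤ (A * B).trace := by
  obtain ⟨C, rfl⟩ : ∃ C, B = star C * C := by
    open scoped MatrixOrder Matrix.Norms.L2Operator in
    exact CStarAlgebra.nonneg_iff_eq_star_mul_self.mp hB.nonneg
  have h := (hA.mul_mul_conjTranspose_same C).trace_nonneg
  rwa [← Matrix.mul_assoc, Matrix.trace_mul_comm, ← Matrix.mul_assoc]

omit [Fintype m] in
theorem posDef_of_sub_smul_one {A : Matrix m m ℝ} {c : ℝ} (hc : 0 < c)
    (h : (A - c • (1 : Matrix m m ℝ)).PosSemidef) : A.PosDef := by
  have h1 := Matrix.PosDef.posSemidef_add h (Matrix.PosDef.one.smul hc)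
  rwa [sub_add_cancel] at h1

/-- Expand `Tr((A - c) A⁻¹) ≥ 0`. -/
theorem trace_inv_le {A : Matrix m m ℝ} {c : ℝ} (hc : 0 < c)
    (h : (A - c • (1 : Matrix m m ℝ)).PosSemidef) : A⁻¹.trace ≤ Fintype.card m / c := by
  have hA := posDef_of_sub_smul_one hc h
  have h1 := trace_mul_nonneg h hA.inv.posSemidef
  have hdet := (Matrix.isUnit_iff_isUnit_det A).mp hA.isUnit
  rw [sub_mul, Matrix.mul_nonsing_inv A hdet, smul_mul_assoc, Matrix.one_mul, Matrix.trace_sub,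
    Matrix.trace_one, Matrix.trace_smul, smul_eq_mul] at h1
  rw [le_div_iff₀ hc]
  linarith

/-- Expanding `Tr((A - 4) A⁻¹ (A - 4)) ≥ 0` gives `16 Tr(A⁻¹) ≥ 8 |m| - Tr A`, and `Tr A ≤ 4 |m|`.
Only the diagonal of `A` needs to be bounded. -/
theorem card_div_four_le_trace_inv {A : Matrix m m ℝ} (hA : A.PosDef) (h : ∀ j, A j j ≤ 4) :
    (Fintype.card m : ℝ) / 4 ≤ A⁻¹.trace := by
  have hdet := (Matrix.isUnit_iff_isUnit_det A).mp hA.isUnit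
  have h1 := (hA.inv.posSemidef.mul_mul_conjTranspose_same
    (A - (4 : ℝ) • (1 : Matrix m m ℝ))).trace_nonneg
  have hH : (A - (4 : ℝ) • (1 : Matrix m m ℝ))ᴴ = A - (4 : ℝ) • (1 : Matrix m m ℝ) := by
    rw [Matrix.conjTranspose_sub, hA.1.eq, Matrix.conjTranspose_smul, Matrix.conjTranspose_one]
    simp
  have h2 : (A - (4 : ℝ) • (1 : Matrix m m ℝ)) * A⁻¹ * (A - (4 : ℝ) • (1 : Matrix m m ℝ)) =
      A - (8 : ℝ) • (1 : Matrix m m ℝ) + (16 : ℝ) • A⁻¹ := by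
    simp only [sub_mul, mul_sub, Matrix.mul_nonsing_inv A hdet, smul_mul_assoc, mul_smul_comm,
      Matrix.one_mul, Matrix.mul_one, Matrix.nonsing_inv_mul A hdet]
    module
  rw [hH, h2, Matrix.trace_add, Matrix.trace_sub, Matrix.trace_smul, Matrix.trace_smul,
    Matrix.trace_one, smul_eq_mul, smul_eq_mul] at h1
  have h3 : A.trace ≤ Fintype.card m * 4 := by
    have : A.trace ≤ ∑ _j : m, (4 : ℝ) := Finset.sum_le_sum fun j _ => h j
    simpa using this
  linarith

end TraceInv

/-! ### Algebra of Pauli operators -/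

section Pauli

variable {n : ℕ}

/-- The tensor product of single-qubit operators. -/
def tensorProd (A : Fin n → Matrix (Fin 2) (Fin 2) ℂ) : Matrix (Qubits n) (Qubits n) ℂ :=
  Matrix.of fun x y => ∏ i, A i (x i) (y i)

theorem sum_prod_pi {κ : Type*} [Fintype κ] (f : Fin n → κ → ℂ) :
    ∑ x : Fin n → κ, ∏ i, f i (x i) = ∏ i, ∑ a, f i a := by
  classical
  rw [Finset.prod_univ_sum, Fintype.piFinset_univ]

theorem tensorProd_mul (A B : Fin n → Matrix (Fin 2) (Fin 2) ℂ) :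
    tensorProd A * tensorProd B = tensorProd fun i => A i * B i := by
  ext x y
  simp only [tensorProd, Matrix.mul_apply, Matrix.of_apply, ← Finset.prod_mul_distrib]
  exact sum_prod_pi fun i a => A i (x i) a * B i a (y i)

theorem tensorProd_smul (z : Fin n → ℂ) (A : Fin n → Matrix (Fin 2) (Fin 2) ℂ) :
    tensorProd (fun i => z i • A i) = (∏ i, z i) • tensorProd A := by
  ext x y
  simp [tensorProd, Finset.prod_mul_distrib]

theorem tensorProd_one : tensorProd (fun _ : Fin n => (1 : Matrix (Fin 2) (Fin 2) ℂ)) = 1 := by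
  ext x y
  simp only [tensorProd, Matrix.of_apply, Matrix.one_apply, Finset.prod_ite_zero,
    Finset.prod_const_one, Finset.mem_univ, true_implies, funext_iff]

theorem pauli_eq_tensorProd (k : Fin n → Fin 4) : pauli k = tensorProd fun i => sigma (k i) := rfl

theorem pauli_zero : pauli (0 : Fin n → Fin 4) = 1 := by
  rw [← tensorProd_one]
  rfl

theorem sigma_isHermitian (a : Fin 4) : (sigma a).IsHermitian := by
  ext x y
  fin_cases a <;> fin_cases x <;> fin_cases y <;> simp [sigma]

theorem sigma_mul_self (a : Fin 4) : sigma a * sigma a = 1 := by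
  ext x y
  fin_cases a <;> fin_cases x <;> fin_cases y <;> simp [sigma, Matrix.mul_apply, Fin.sum_univ_two]

/-- The sign `±1` with which two single-qubit Pauli operators commute. -/
def sigmaSign (a b : Fin 4) : ℤ := if a = 0 ∨ b = 0 ∨ a = b then 1 else -1

theorem sigma_mul_comm (a b : Fin 4) :
    sigma a * sigma b = (sigmaSign a b : ℂ) • (sigma b * sigma a) := by
  ext x y
  fin_cases a <;> fin_cases b <;> fin_cases x <;> fin_cases y <;>
    simp [sigma, sigmaSign, Matrix.mul_apply, Fin.sum_univ_two]

theorem exists_sigma_mul (a b : Fin 4) :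
    ∃ (l : Fin 4) (z : ℂ), ‖z‖ = 1 ∧ sigma a * sigma b = z • sigma l := by
  by_cases ha : a = 0
  · exact ⟨b, 1, by simp, by simp [ha, sigma]⟩
  by_cases hb : b = 0
  · exact ⟨a, 1, by simp, by simp [hb, sigma]⟩
  by_cases hab : a = b
  · exact ⟨0, 1, by simp, by rw [hab, sigma_mul_self]; simp [sigma]⟩
  have key : ∀ a b c : Fin 4, ∀ z : ℂ, (∀ x y, (sigma a * sigma b) x y = (z • sigma c) x y) →
      sigma a * sigma b = z • sigma c := fun a b c z h => Matrix.ext h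
  have hcases : (a = 1 ∧ b = 2) ∨ (a = 2 ∧ b = 3) ∨ (a = 3 ∧ b = 1) ∨
      (a = 2 ∧ b = 1) ∨ (a = 3 ∧ b = 2) ∨ (a = 1 ∧ b = 3) := by
    revert a b
    decide
  rcases hcases with ⟨rfl, rfl⟩ | ⟨rfl, rfl⟩ | ⟨rfl, rfl⟩ | ⟨rfl, rfl⟩ | ⟨rfl, rfl⟩ | ⟨rfl, rfl⟩
  · exact ⟨3, Complex.I, by simp, key _ _ _ _ fun x y => by
      fin_cases x <;> fin_cases y <;> simp [sigma, Matrix.mul_apply, Fin.sum_univ_two]⟩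
  · exact ⟨1, Complex.I, by simp, key _ _ _ _ fun x y => by
      fin_cases x <;> fin_cases y <;> simp [sigma, Matrix.mul_apply, Fin.sum_univ_two]⟩
  · exact ⟨2, Complex.I, by simp, key _ _ _ _ fun x y => by
      fin_cases x <;> fin_cases y <;> simp [sigma, Matrix.mul_apply, Fin.sum_univ_two]⟩
  · exact ⟨3, -Complex.I, by simp, key _ _ _ _ fun x y => by
      fin_cases x <;> fin_cases y <;> simp [sigma, Matrix.mul_apply, Fin.sum_univ_two]⟩
  · exact ⟨1, -Complex.I, by simp, key _ _ _ _ fun x y => by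
      fin_cases x <;> fin_cases y <;> simp [sigma, Matrix.mul_apply, Fin.sum_univ_two]⟩
  · exact ⟨2, -Complex.I, by simp, key _ _ _ _ fun x y => by
      fin_cases x <;> fin_cases y <;> simp [sigma, Matrix.mul_apply, Fin.sum_univ_two]⟩

theorem sum_sigma_mul_sigma (x y x' y' : Fin 2) :
    ∑ a, sigma a x y * sigma a x' y' = if x = y' ∧ y = x' then 2 else 0 := by
  fin_cases x <;> fin_cases y <;> fin_cases x' <;> fin_cases y' <;>
    simp [sigma, Fin.sum_univ_four] <;> norm_num

theorem pauli_isHermitian (k : Fin n → Fin 4) : (pauli k).IsHermitian := by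
  ext x y
  simp only [Matrix.conjTranspose_apply, pauli, Matrix.of_apply, star_prod]
  exact Finset.prod_congr rfl fun i _ => congrFun (congrFun (sigma_isHermitian (k i)) (x i)) (y i)

theorem pauli_mul_self (k : Fin n → Fin 4) : pauli k * pauli k = 1 := by
  rw [pauli_eq_tensorProd, tensorProd_mul]
  simp only [sigma_mul_self, tensorProd_one]

/-- The sign `±1` with which two Pauli operators commute. -/
def pauliSign (k l : Fin n → Fin 4) : ℤ := ∏ i, sigmaSign (k i) (l i)

theorem pauli_mul_comm (k l : Fin n → Fin 4) :
    pauli k * pauli l = (pauliSign k l : ℂ) • (pauli l * pauli k) := by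
  simp only [pauli_eq_tensorProd, tensorProd_mul]
  rw [pauliSign, Int.cast_prod, ← tensorProd_smul]
  simp only [← sigma_mul_comm]

theorem exists_pauli_mul (k l : Fin n → Fin 4) :
    ∃ (j : Fin n → Fin 4) (z : ℂ), ‖z‖ = 1 ∧ pauli k * pauli l = z • pauli j := by
  choose j z hz h using fun i => exists_sigma_mul (k i) (l i)
  refine ⟨j, ∏ i, z i, by simp [hz], ?_⟩
  simp only [pauli_eq_tensorProd, tensorProd_mul, h, tensorProd_smul]

theorem pauliSign_eq (k l : Fin n → Fin 4) : pauliSign k l = 1 ∨ pauliSign k l = -1 := by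
  rw [← Int.isUnit_iff, pauliSign]
  refine IsUnit.prod_univ_iff.mpr fun i => ?_
  rw [sigmaSign]
  split_ifs <;> simp

theorem pauliSign_zero (k : Fin n → Fin 4) : pauliSign 0 k = 1 := by
  simp [pauliSign, sigmaSign]

/-- Orthogonality of characters: the sum is a product over qubits, and the factor at a qubit where
`i` and `j` differ vanishes. -/
theorem sum_pauliSign_mul {i j : Fin n → Fin 4} (h : i ≠ j) :
    ∑ k, pauliSign i k * pauliSign j k = 0 := by
  obtain ⟨a, ha⟩ := Function.ne_iff.mp h
  have h1 : ∀ u v : Fin 4, u ≠ v → ∑ b, sigmaSign u b * sigmaSign v b = 0 := by decide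
  simp only [pauliSign, ← Finset.prod_mul_distrib]
  have h2 := Finset.prod_univ_sum (fun _ : Fin n => (Finset.univ : Finset (Fin 4)))
    fun a b => sigmaSign (i a) b * sigmaSign (j a) b
  rw [Fintype.piFinset_univ] at h2
  rw [← h2]
  exact Finset.prod_eq_zero (Finset.mem_univ a) (h1 _ _ ha)

/-- Distinct Pauli operators are distinguished by their commutation signs. -/
theorem exists_pauliSign_mul_eq_neg_one {i j : Fin n → Fin 4} (h : i ≠ j) :
    ∃ k, pauliSign i k * pauliSign j k = -1 := by
  by_contra! hne
  have h1 : ∀ k, pauliSign i k * pauliSign j k = 1 := fun k => by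
    have := hne k
    rcases pauliSign_eq i k with h1 | h1 <;> rcases pauliSign_eq j k with h2 | h2 <;>
      simp_all
  have h2 := sum_pauliSign_mul h
  simp [h1] at h2

theorem sum_pauliSign {i : Fin n → Fin 4} (h : i ≠ 0) : ∑ k, pauliSign i k = 0 := by
  have := sum_pauliSign_mul h
  simpa [pauliSign_zero] using this

/-- Some Pauli operator anticommutes with both of two given ones. -/
theorem exists_anticommuting {i j : Fin n → Fin 4} (hi : i ≠ 0) (hj : j ≠ 0) (h : i ≠ j) :
    ∃ k, pauliSign i k = -1 ∧ pauliSign j k = -1 := by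
  by_contra! hne
  have h1 : ∀ k, (1 - pauliSign i k) * (1 - pauliSign j k) = 0 := fun k => by
    rcases pauliSign_eq i k with h1 | h1
    · simp [h1]
    · simp [(pauliSign_eq j k).resolve_right (hne k h1)]
  -- A term is nonzero only when both signs are `-1`. By orthogonality only the constant term of the
  -- product survives, so the sum is positive.
  have h2 : ∑ k, (1 - pauliSign i k) * (1 - pauliSign j k) = 4 ^ n := by
    simp only [sub_mul, mul_sub, one_mul, mul_one, Finset.sum_sub_distrib, sum_pauliSign hi,
      sum_pauliSign hj, sum_pauliSign_mul h]
    simp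
  simp only [h1, Finset.sum_const_zero] at h2
  exact absurd h2 (by positivity)

theorem pauli_conj (k l : Fin n → Fin 4) :
    pauli k * pauli l * pauli k = (pauliSign l k : ℂ) • pauli l := by
  rw [Matrix.mul_assoc, pauli_mul_comm l k, mul_smul_comm, ← Matrix.mul_assoc, pauli_mul_self,
    Matrix.one_mul]

theorem pauli_conj_mul (k i j : Fin n → Fin 4) :
    pauli k * (pauli i * pauli j) * pauli k =
      (pauliSign i k * pauliSign j k : ℂ) • (pauli i * pauli j) := by
  calc pauli k * (pauli i * pauli j) * pauli k
      = (pauli k * pauli i * pauli k) * (pauli k * pauli j * pauli k) := by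
        calc _ = pauli k * pauli i * 1 * (pauli j * pauli k) := by
              simp only [Matrix.mul_assoc, Matrix.one_mul]
          _ = _ := by rw [← pauli_mul_self k]; simp only [Matrix.mul_assoc]
    _ = _ := by rw [pauli_conj, pauli_conj, smul_mul_smul_comm]

/-- For `i ≠ j` some Pauli conjugation negates the product `P_i P_j`, while conjugation preserves
the trace. -/
theorem trace_pauli_mul_pauli (i j : Fin n → Fin 4) :
    (pauli i * pauli j).trace = if i = j then 2 ^ n else 0 := by
  split_ifs with h
  · rw [h, pauli_mul_self, Matrix.trace_one]
    simp
  · obtain ⟨k, hk⟩ := exists_pauliSign_mul_eq_neg_one h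
    have h1 := congrArg Matrix.trace (pauli_conj_mul k i j)
    rw [Matrix.trace_mul_comm, ← Matrix.mul_assoc, pauli_mul_self, Matrix.one_mul,
      Matrix.trace_smul] at h1
    have h2 : (pauliSign i k * pauliSign j k : ℂ) = -1 := by exact_mod_cast hk
    rw [h2, smul_eq_mul, neg_one_mul] at h1
    exact self_eq_neg.mp h1

theorem trace_pauli {i : Fin n → Fin 4} (h : i ≠ 0) : (pauli i).trace = 0 := by
  have := trace_pauli_mul_pauli i 0
  rwa [pauli_zero, Matrix.mul_one, if_neg h] at this

/-- Entrywise form of `∑ P_k ⊗ P_k = 2ⁿ SWAP`, which follows qubit by qubit. It turns the sum of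
squared Pauli expectations into the purity. -/
theorem sum_pauli_mul_pauli (x y x' y' : Qubits n) :
    ∑ k : Fin n → Fin 4, pauli k x y * pauli k x' y' =
      if x = y' ∧ y = x' then 2 ^ n else 0 := by
  simp only [pauli, Matrix.of_apply, ← Finset.prod_mul_distrib]
  rw [sum_prod_pi fun i a => sigma a (x i) (y i) * sigma a (x' i) (y' i)]
  simp only [sum_sigma_mul_sigma, Finset.prod_ite_zero, Finset.prod_const, Finset.mem_univ,
    true_implies, forall_and, funext_iff, Finset.card_univ, Fintype.card_fin]

/-- The Pauli expectation values of a pure state. -/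
theorem sum_prob_pauli_sq {ψ : Qubits n → ℂ} (hψ : IsKet ψ) :
    ∑ k : Fin n → Fin 4, prob (ketbra ψ) (pauli k) ^ 2 = 2 ^ n := by
  have h1 : ∑ k : Fin n → Fin 4, (ketbra ψ * pauli k).trace * (ketbra ψ * pauli k).trace =
      2 ^ n * (ketbra ψ * ketbra ψ).trace := by
    simp only [Matrix.trace, Matrix.diag_apply, Matrix.mul_apply, Finset.sum_mul_sum]
    have h2 : ∀ x y x' y' : Qubits n, ∑ k : Fin n → Fin 4,
        ketbra ψ x y * pauli k y x * (ketbra ψ x' y' * pauli k y' x') =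
        if y = x' ∧ x = y' then 2 ^ n * (ketbra ψ x y * ketbra ψ x' y') else 0 := by
      intro x y x' y'
      have h3 : ∀ k : Fin n → Fin 4, ketbra ψ x y * pauli k y x * (ketbra ψ x' y' * pauli k y' x') =
          ketbra ψ x y * ketbra ψ x' y' * (pauli k y x * pauli k y' x') := fun k => by ring
      simp only [h3, ← Finset.mul_sum, sum_pauli_mul_pauli]
      split_ifs <;> ring
    rw [Finset.sum_comm, Finset.mul_sum]
    refine Finset.sum_congr rfl fun x _ => ?_
    rw [Finset.sum_comm]
    have h4 : ∀ x' : Qubits n, ∑ k : Fin n → Fin 4, ∑ y, ∑ y',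
        ketbra ψ x y * pauli k y x * (ketbra ψ x' y' * pauli k y' x') =
        ∑ y, ∑ y', if y = x' ∧ x = y' then 2 ^ n * (ketbra ψ x y * ketbra ψ x' y') else 0 := by
      intro x'
      rw [Finset.sum_comm]
      refine Finset.sum_congr rfl fun y _ => ?_
      rw [Finset.sum_comm]
      exact Finset.sum_congr rfl fun y' _ => h2 x y x' y'
    simp only [h4, ite_and, Finset.sum_ite_irrel, Finset.sum_const_zero, Finset.sum_ite_eq,
      Finset.sum_ite_eq', Finset.mem_univ, if_true, Finset.mul_sum]
  have h5 : ketbra ψ * ketbra ψ = ketbra ψ := by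
    have hψ' : star ψ ⬝ᵥ ψ = 1 := hψ
    rw [ketbra, Matrix.vecMulVec_mul_vecMulVec, hψ']; simp
  simp only [h5, hψ.trace_ketbra, mul_one,
    trace_mul_of_isHermitian (ketbra_isHermitian ψ) (pauli_isHermitian _), ← sq] at h1
  exact_mod_cast h1

end Pauli

/-! ### Clifford symmetry and second moments of random stabilizer states -/

section Stabilizer

variable {n : ℕ}

theorem IsClifford.mul {U V : Matrix (Qubits n) (Qubits n) ℂ} (hU : IsClifford U)
    (hV : IsClifford V) : IsClifford (U * V) := by
  refine ⟨mul_mem hU.1 hV.1, fun k => ?_⟩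
  have e : U * V * pauli k * (U * V)ᴴ = U * (V * pauli k * Vᴴ) * Uᴴ := by
    rw [Matrix.conjTranspose_mul]
    simp only [Matrix.mul_assoc]
  obtain ⟨l, hl | hl⟩ := hV.2 k <;> obtain ⟨j, hj | hj⟩ := hU.2 l <;> refine ⟨j, ?_⟩ <;>
    rw [e, hl] <;> simp [hj]

theorem IsClifford.one : IsClifford (1 : Matrix (Qubits n) (Qubits n) ℂ) :=
  ⟨one_mem _, fun k => ⟨k, Or.inl (by simp)⟩⟩

instance instNonemptyCliffordClass : Nonempty (CliffordClass n) :=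
  ⟨Quotient.mk (phaseSetoid n) ⟨1, IsClifford.one⟩⟩

/-- Multiplication of Clifford classes by a Clifford unitary from the left. -/
def cliffordMul (U : Matrix (Qubits n) (Qubits n) ℂ) (hU : IsClifford U) :
    CliffordClass n → CliffordClass n :=
  Quotient.map (sa := phaseSetoid n) (sb := phaseSetoid n) (fun V => ⟨U * V.1, hU.mul V.2⟩) (by
    rintro V V' ⟨z, hz, h⟩
    exact ⟨z, hz, by simp only [h, mul_smul_comm]⟩)

theorem cliffordMul_involutive {U : Matrix (Qubits n) (Qubits n) ℂ} (hU : IsClifford U)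
    (h : U * U = 1) : Function.Involutive (cliffordMul U hU) := by
  intro c
  induction c using Quotient.inductionOn with
  | h V =>
    refine congrArg (Quotient.mk (phaseSetoid n)) (Subtype.ext ?_)
    change U * (U * V.1) = V.1
    rw [← Matrix.mul_assoc, h, Matrix.one_mul]

/-- The representative chosen for the product class differs from `U` times the old representative by
a phase, which cancels in the rank-one projection. -/
theorem stabilizerKet_cliffordMul {U : Matrix (Qubits n) (Qubits n) ℂ} (hU : IsClifford U)
    (c : CliffordClass n) :
    ketbra (stabilizerKet (cliffordMul U hU c)) = U * ketbra (stabilizerKet c) * Uᴴ := by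
  have h0 : cliffordMul U hU c =
      Quotient.mk (phaseSetoid n) ⟨U * c.unitary, hU.mul (Quotient.out c).2⟩ := by
    conv_lhs => rw [← Quotient.out_eq c]
    rfl
  obtain ⟨z, hz, h⟩ : (phaseSetoid n).r (Quotient.out (cliffordMul U hU c))
      ⟨U * c.unitary, hU.mul (Quotient.out c).2⟩ :=
    Quotient.exact ((Quotient.out_eq _).trans h0)
  have hz' : z * star z = 1 := by
    rw [RCLike.star_def, Complex.mul_conj', hz]
    simp
  have h1 : stabilizerKet (cliffordMul U hU c) = z • (U *ᵥ stabilizerKet c) := by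
    rw [stabilizerKet, CliffordClass.unitary, h, stabilizerKet, Matrix.smul_mulVec,
      Matrix.mulVec_mulVec]
  rw [h1, ketbra, star_smul, Matrix.vecMulVec_smul, Matrix.smul_vecMulVec, smul_smul, mul_comm,
    hz', one_smul, ketbra, Matrix.star_mulVec, Matrix.mul_vecMulVec, Matrix.vecMulVec_mul]

theorem isKet_stabilizerKet (c : CliffordClass n) : IsKet (stabilizerKet c) := by
  have h : (c.unitary)ᴴ * c.unitary = 1 := (Unitary.mem_iff.mp (Quotient.out c).2.1).1
  rw [IsKet, stabilizerKet, Matrix.star_mulVec, ← Matrix.dotProduct_mulVec, Matrix.mulVec_mulVec,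
    h, Matrix.one_mulVec]
  simp

/-- A sum over the stabilizer ensemble is invariant under a Clifford involution. -/
theorem sum_cliffordClass_conj {U : Matrix (Qubits n) (Qubits n) ℂ} (hU : IsClifford U)
    (h : U * U = 1) (hH : U.IsHermitian) (f : Matrix (Qubits n) (Qubits n) ℂ → ℝ) :
    ∑ c : CliffordClass n, f (U * ketbra (stabilizerKet c) * U) =
      ∑ c : CliffordClass n, f (ketbra (stabilizerKet c)) := by
  rw [← Equiv.sum_comp (cliffordMul_involutive hU h).toPerm]
  refine Finset.sum_congr rfl fun c _ => ?_
  rw [Function.Involutive.coe_toPerm, stabilizerKet_cliffordMul, hH.eq]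
  congr 1
  calc U * (U * ketbra (stabilizerKet c) * U) * U
      = (U * U) * ketbra (stabilizerKet c) * (U * U) := by simp only [Matrix.mul_assoc]
    _ = _ := by rw [h, Matrix.one_mul, Matrix.mul_one]

theorem prob_conj {S : Type*} [Fintype S] (U ρ A : Matrix S S ℂ) :
    prob (U * ρ * U) A = prob ρ (U * A * U) := by
  rw [prob, prob]
  congr 1
  rw [Matrix.mul_assoc, Matrix.mul_assoc, Matrix.trace_mul_comm]
  simp only [Matrix.mul_assoc]

theorem isClifford_pauli (k : Fin n → Fin 4) : IsClifford (pauli k) := by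
  refine ⟨?_, fun l => ⟨l, ?_⟩⟩
  · rw [Matrix.mem_unitaryGroup_iff, Matrix.star_eq_conjTranspose, (pauli_isHermitian k).eq,
      pauli_mul_self]
  · rw [(pauli_isHermitian k).eq, pauli_conj]
    rcases pauliSign_eq l k with h | h <;> simp [h]

theorem prob_smul_right {S : Type*} [Fintype S] (c : ℝ) (A B : Matrix S S ℂ) :
    prob A ((c : ℂ) • B) = c * prob A B := by
  rw [prob_comm, prob_smul, prob_comm]

theorem prob_pauli_conj (ρ : Matrix (Qubits n) (Qubits n) ℂ) (i k : Fin n → Fin 4) :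
    prob (pauli k * ρ * pauli k) (pauli i) = pauliSign i k * prob ρ (pauli i) := by
  rw [prob_conj, pauli_conj, ← prob_smul_right]
  push_cast
  rfl

/-- The ensemble is invariant under conjugation by a `P_k` that negates `P_i P_j`, so the sum equals
its own negative. -/
theorem sum_prob_pauli_mul_pauli {i j : Fin n → Fin 4} (h : i ≠ j) :
    ∑ c : CliffordClass n, prob (ketbra (stabilizerKet c)) (pauli i * pauli j) = 0 := by
  obtain ⟨k, hk⟩ := exists_pauliSign_mul_eq_neg_one h
  have h1 := sum_cliffordClass_conj (isClifford_pauli k) (pauli_mul_self k) (pauli_isHermitian k)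
    fun ρ => prob ρ (pauli i * pauli j)
  have h2 : (pauliSign i k * pauliSign j k : ℂ) = ((-1 : ℝ) : ℂ) := by
    push_cast
    exact_mod_cast hk
  simp only [prob_conj, pauli_conj_mul, h2, prob_smul_right, ← Finset.mul_sum] at h1
  linarith

theorem sum_prob_pauli_mul_prob_pauli {i j : Fin n → Fin 4} (h : i ≠ j) :
    ∑ c : CliffordClass n, prob (ketbra (stabilizerKet c)) (pauli i) *
      prob (ketbra (stabilizerKet c)) (pauli j) = 0 := by
  obtain ⟨k, hk⟩ := exists_pauliSign_mul_eq_neg_one h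
  have h1 := sum_cliffordClass_conj (isClifford_pauli k) (pauli_mul_self k) (pauli_isHermitian k)
    fun ρ => prob ρ (pauli i) * prob ρ (pauli j)
  have h2 : (pauliSign i k * pauliSign j k : ℝ) = -1 := by exact_mod_cast hk
  simp only [prob_pauli_conj, mul_mul_mul_comm, h2, ← Finset.mul_sum] at h1
  linarith

/-- The involution `(P_i + P_j) / √2` that exchanges two anticommuting Pauli operators. -/
def pauliExchange (i j : Fin n → Fin 4) : Matrix (Qubits n) (Qubits n) ℂ :=
  (((Real.sqrt 2)⁻¹ : ℝ) : ℂ) • (pauli i + pauli j)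

theorem inv_sqrt_two_mul_self :
    (((Real.sqrt 2)⁻¹ : ℝ) : ℂ) * (((Real.sqrt 2)⁻¹ : ℝ) : ℂ) = 1 / 2 := by
  rw [← Complex.ofReal_mul, ← mul_inv, Real.mul_self_sqrt (by norm_num)]
  norm_num

theorem pauli_anticommute {i j : Fin n → Fin 4} (h : pauliSign i j = -1) :
    pauli i * pauli j = -(pauli j * pauli i) := by
  rw [pauli_mul_comm, h]
  simp

theorem pauliExchange_isHermitian (i j : Fin n → Fin 4) : (pauliExchange i j).IsHermitian := by
  rw [Matrix.IsHermitian, pauliExchange, Matrix.conjTranspose_smul, Matrix.conjTranspose_add,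
    (pauli_isHermitian i).eq, (pauli_isHermitian j).eq, RCLike.star_def, Complex.conj_ofReal]

theorem pauliExchange_mul_self {i j : Fin n → Fin 4} (h : pauliSign i j = -1) :
    pauliExchange i j * pauliExchange i j = 1 := by
  rw [pauliExchange, smul_mul_smul_comm, inv_sqrt_two_mul_self, add_mul, mul_add, mul_add,
    pauli_mul_self, pauli_mul_self, pauli_anticommute h]
  module

theorem pauliExchange_conj (i j k : Fin n → Fin 4) :
    pauliExchange i j * pauli k * pauliExchange i j =
      (1 / 2 : ℂ) • (pauli i * pauli k * pauli i + pauli j * pauli k * pauli j +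
        (pauli i * pauli k * pauli j + pauli j * pauli k * pauli i)) := by
  rw [pauliExchange, smul_mul_assoc, smul_mul_smul_comm, inv_sqrt_two_mul_self]
  simp only [add_mul, mul_add]
  congr 1
  abel

theorem pauliExchange_conj_left {i j : Fin n → Fin 4} (h : pauliSign i j = -1) :
    pauliExchange i j * pauli i * pauliExchange i j = pauli j := by
  rw [pauliExchange_conj, pauli_mul_self, Matrix.one_mul, Matrix.one_mul, pauli_conj, h,
    Matrix.mul_assoc (pauli j), pauli_mul_self, Matrix.mul_one]
  push_cast
  module

/-- With `s_i`, `s_j` the commutation signs of `P_k` with `P_i`, `P_j`, the conjugate of `P_k` is `½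
((s_i + s_j) P_k + (s_i - s_j) P_k P_i P_j)`. This is `± P_k` or `± P_k P_i P_j`. -/
theorem isClifford_pauliExchange {i j : Fin n → Fin 4} (h : pauliSign i j = -1) :
    IsClifford (pauliExchange i j) := by
  have hH := pauliExchange_isHermitian i j
  refine ⟨?_, fun k => ?_⟩
  · rw [Matrix.mem_unitaryGroup_iff, Matrix.star_eq_conjTranspose, hH.eq, pauliExchange_mul_self h]
  have hanti := pauli_anticommute h
  have hik : pauli i * pauli k * pauli j = (pauliSign i k : ℂ) • (pauli k * (pauli i * pauli j)) := by
    rw [pauli_mul_comm i k, smul_mul_assoc, Matrix.mul_assoc]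
  have hjk : pauli j * pauli k * pauli i =
      -((pauliSign j k : ℂ) • (pauli k * (pauli i * pauli j))) := by
    rw [pauli_mul_comm j k, smul_mul_assoc, Matrix.mul_assoc, hanti]
    simp
  have hsym : ∀ k l : Fin n → Fin 4, pauliSign k l = pauliSign l k := fun k l => by
    simp only [pauliSign, sigmaSign, eq_comm, or_comm, or_left_comm]
  have hconj := pauliExchange_conj i j k
  rw [hik, hjk, pauli_conj, pauli_conj, hsym k i, hsym k j] at hconj
  rw [hH.eq]
  have hHerm : (pauliExchange i j * pauli k * pauliExchange i j).IsHermitian := by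
    have := Matrix.isHermitian_conjTranspose_mul_mul (pauliExchange i j) (pauli_isHermitian k)
    rwa [hH.eq] at this
  by_cases hs : pauliSign i k = pauliSign j k
  · refine ⟨k, ?_⟩
    rw [hs] at hconj
    rcases pauliSign_eq j k with h1 | h1
    · left; rw [hconj, h1]; push_cast; module
    · right; rw [hconj, h1]; push_cast; module
  · obtain ⟨l, z, hz, hl⟩ := exists_pauli_mul i j
    obtain ⟨l', z', hz', hl'⟩ := exists_pauli_mul k l
    have hu : ∃ u : ℂ, ‖u‖ = 1 ∧
        pauliExchange i j * pauli k * pauliExchange i j = u • pauli l' := by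
      rcases pauliSign_eq i k with h1 | h1 <;> rcases pauliSign_eq j k with h2 | h2
      · exact absurd (h1.trans h2.symm) hs
      · refine ⟨z * z', by simp [hz, hz'], ?_⟩
        rw [hconj, h1, h2, hl, mul_smul_comm, hl']
        push_cast
        module
      · refine ⟨-(z * z'), by simp [hz, hz'], ?_⟩
        rw [hconj, h1, h2, hl, mul_smul_comm, hl']
        push_cast
        module
      · exact absurd (h1.trans h2.symm) hs
    obtain ⟨u, hu1, hu⟩ := hu
    -- The conjugate is Hermitian, which forces the unimodular phase `u` to be real, hence `±1`.
    have hstar : star u • pauli l' = u • pauli l' := by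
      have h3 := hHerm
      rw [hu, Matrix.IsHermitian, Matrix.conjTranspose_smul, (pauli_isHermitian l').eq] at h3
      exact h3
    have hreal : star u = u := by
      have h3 := congrArg (fun A => A * pauli l') hstar
      simp only [smul_mul_assoc, pauli_mul_self] at h3
      have h4 := congrFun (congrFun h3 0) 0
      simpa using h4
    have hre : (u.re : ℂ) = u := Complex.conj_eq_iff_re.mp hreal
    rw [← hre, Complex.norm_real, Real.norm_eq_abs] at hu1
    refine ⟨l', ?_⟩
    rcases eq_or_eq_neg_of_abs_eq hu1 with h3 | h3
    · left; rw [hu, ← hre, h3]; simp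
    · right; rw [hu, ← hre, h3]; simp

theorem sum_prob_pauli_sq_of_anticommute {i j : Fin n → Fin 4} (h : pauliSign i j = -1) :
    ∑ c : CliffordClass n, prob (ketbra (stabilizerKet c)) (pauli j) ^ 2 =
      ∑ c : CliffordClass n, prob (ketbra (stabilizerKet c)) (pauli i) ^ 2 := by
  have h1 := sum_cliffordClass_conj (isClifford_pauliExchange h) (pauliExchange_mul_self h)
    (pauliExchange_isHermitian i j) fun ρ => prob ρ (pauli i) ^ 2
  simpa only [prob_conj, pauliExchange_conj_left h] using h1

/-- All Pauli operators other than the identity have the same mean square expectation value. -/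
theorem sum_prob_pauli_sq_eq {i j : Fin n → Fin 4} (hi : i ≠ 0) (hj : j ≠ 0) :
    ∑ c : CliffordClass n, prob (ketbra (stabilizerKet c)) (pauli j) ^ 2 =
      ∑ c : CliffordClass n, prob (ketbra (stabilizerKet c)) (pauli i) ^ 2 := by
  by_cases h : i = j
  · rw [h]
  · obtain ⟨k, h1, h2⟩ := exists_anticommuting hi hj h
    rw [← sum_prob_pauli_sq_of_anticommute h1, ← sum_prob_pauli_sq_of_anticommute h2]

theorem card_pauliIdx : (Fintype.card (PauliIdx n) : ℝ) = (2 ^ n) ^ 2 - 1 := by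
  have h : Fintype.card (PauliIdx n) = 4 ^ n - 1 := by
    rw [Fintype.card_subtype_compl]
    simp
  rw [h, Nat.cast_sub (Nat.one_le_pow _ _ (by norm_num)), ← pow_mul, mul_comm, pow_mul]
  norm_num

/-- The mean square expectation value of a Pauli operator in a random stabilizer state. -/
theorem sum_prob_pauli_sq_stabilizer {i : Fin n → Fin 4} (hi : i ≠ 0) :
    ∑ c : CliffordClass n, prob (ketbra (stabilizerKet c)) (pauli i) ^ 2 =
      Fintype.card (CliffordClass n) / ((2 : ℝ) ^ n + 1) := by
  classical
  have h1 : ∑ c : CliffordClass n, ∑ k : Fin n → Fin 4,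
      prob (ketbra (stabilizerKet c)) (pauli k) ^ 2 = Fintype.card (CliffordClass n) * 2 ^ n := by
    simp [sum_prob_pauli_sq (isKet_stabilizerKet _)]
  rw [Finset.sum_comm, ← Finset.add_sum_erase _ _ (Finset.mem_univ 0)] at h1
  have h0 : ∀ c : CliffordClass n, prob (ketbra (stabilizerKet c)) (pauli 0) = 1 := fun c => by
    rw [pauli_zero, prob, Matrix.mul_one, (isKet_stabilizerKet c).trace_ketbra, Complex.one_re]
  have h2 : ∑ k ∈ Finset.univ.erase (0 : Fin n → Fin 4), ∑ c : CliffordClass n,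
      prob (ketbra (stabilizerKet c)) (pauli k) ^ 2 =
      ((2 ^ n) ^ 2 - 1) *
        ∑ c : CliffordClass n, prob (ketbra (stabilizerKet c)) (pauli i) ^ 2 := by
    rw [Finset.sum_congr rfl fun k hk => sum_prob_pauli_sq_eq hi (Finset.ne_of_mem_erase hk),
      Finset.sum_const, nsmul_eq_mul, ← card_pauliIdx, Finset.card_erase_of_mem (Finset.mem_univ _),
      Finset.card_univ, Fintype.card_subtype_compl]
    simp
  rw [h2] at h1
  simp only [h0, one_pow, Finset.sum_const, Finset.card_univ, nsmul_eq_mul, mul_one] at h1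
  -- If `S` is the sum sought and `C` the number of classes, then `C + (d² - 1) S = C d`. Solving
  -- for `S` cancels a factor `d - 1`, nonzero because a nonidentity label exists only for `n ≥ 1`.
  have hn : n ≠ 0 := by
    rintro rfl
    exact hi (Subsingleton.elim _ _)
  have hd : (1 : ℝ) < 2 ^ n := one_lt_pow₀ (by norm_num) hn
  rw [eq_div_iff (by positivity)]
  have h3 : ((2 : ℝ) ^ n - 1) * ((∑ c : CliffordClass n,
      prob (ketbra (stabilizerKet c)) (pauli i) ^ 2) * (2 ^ n + 1) -
        Fintype.card (CliffordClass n)) = 0 := by linear_combination h1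
  exact sub_eq_zero.mp ((mul_eq_zero.mp h3).resolve_left (by linarith))

theorem variance_sum {S m : Type*} [Fintype S] [Fintype m] (ψ : S → ℂ)
    (Q : m → Matrix S S ℂ) (c : m → ℝ) :
    variance ψ (∑ j, (c j : ℂ) • Q j) = ∑ i, ∑ j, c i * c j *
      (prob (ketbra ψ) (Q i * Q j) - prob (ketbra ψ) (Q i) * prob (ketbra ψ) (Q j)) := by
  have h1 : prob (ketbra ψ) (∑ j, (c j : ℂ) • Q j) = ∑ j, c j * prob (ketbra ψ) (Q j) := by
    rw [prob_comm, prob_sum]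
    simp only [prob_smul, prob_comm (ketbra ψ)]
  have h2 : prob (ketbra ψ) ((∑ j, (c j : ℂ) • Q j) * ∑ j, (c j : ℂ) • Q j) =
      ∑ i, ∑ j, c i * c j * prob (ketbra ψ) (Q i * Q j) := by
    rw [Finset.sum_mul_sum, prob_comm, prob_sum]
    refine Finset.sum_congr rfl fun i _ => ?_
    rw [prob_sum]
    refine Finset.sum_congr rfl fun j _ => ?_
    rw [smul_mul_smul_comm, ← Complex.ofReal_mul, prob_smul, prob_comm]
  rw [variance, h1, h2, sq, Finset.sum_mul_sum, ← Finset.sum_sub_distrib]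
  refine Finset.sum_congr rfl fun i _ => ?_
  rw [← Finset.sum_sub_distrib]
  exact Finset.sum_congr rfl fun j _ => by ring

/-- The mean variance of a Hamiltonian in a random stabilizer state. -/
theorem sum_variance_stabilizer (c : PauliIdx n → ℝ) :
    ∑ C : CliffordClass n, variance (stabilizerKet C) (∑ k, (c k : ℂ) • pauli k.1) =
      Fintype.card (CliffordClass n) * ((2 : ℝ) ^ n / (2 ^ n + 1)) * (c ⬝ᵥ c) := by
  simp only [variance_sum (Q := fun k : PauliIdx n => pauli k.1)]
  rw [Finset.sum_comm, dotProduct, Finset.mul_sum]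
  refine Finset.sum_congr rfl fun i _ => ?_
  rw [Finset.sum_comm, Finset.sum_eq_single i]
  · have h1 : ∀ C : CliffordClass n,
        prob (ketbra (stabilizerKet C)) (pauli i.1 * pauli i.1) = 1 := fun C => by
      rw [pauli_mul_self, prob, Matrix.mul_one, (isKet_stabilizerKet C).trace_ketbra,
        Complex.one_re]
    simp only [h1]
    simp only [← Finset.mul_sum, Finset.sum_sub_distrib, ← sq,
      sum_prob_pauli_sq_stabilizer i.2]
    simp only [Finset.sum_const, Finset.card_univ, nsmul_eq_mul, mul_one]
    have : (2 : ℝ) ^ n + 1 ≠ 0 := by positivity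
    field_simp
    ring
  · intro j _ hj
    have hij : i.1 ≠ j.1 := fun h => hj (Subtype.ext h.symm)
    rw [← Finset.mul_sum, Finset.sum_sub_distrib, sum_prob_pauli_mul_pauli hij,
      sum_prob_pauli_mul_prob_pauli hij]
    simp
  · simp

end Stabilizer

/-! ### Evolution, ancillas and the maximally entangled state -/

section Evolution

variable {n : ℕ}

/-- On a coordinate axis the exponent is a real multiple of one fixed matrix. The partial
derivatives at `0` therefore need no formula for exponentials of noncommuting sums. -/
theorem evolution_smul_single (t : ℝ) (j : PauliIdx n) :
    evolution (t • Pi.single j 1) = NormedSpace.exp (t • (-Complex.I • pauli j.1)) := by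
  rw [evolution, Finset.sum_eq_single j]
  · simp only [Pi.smul_apply, Pi.single_eq_same, smul_eq_mul, mul_one]
    rw [smul_comm, Complex.coe_smul]
  · intro k _ hk
    simp [Pi.single_eq_of_ne hk]
  · simp

open scoped Matrix.Norms.Operator in
theorem isGeneratedBy_evolution :
    IsGeneratedBy (evolution (n := n)) fun k : PauliIdx n => pauli k.1 := by
  refine ⟨?_, fun j a b => ?_⟩
  · simp [evolution, NormedSpace.exp_zero]
  · have h := hasDerivAt_exp_smul_const (𝕂 := ℝ) (-Complex.I • pauli j.1) (0 : ℝ)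
    rw [zero_smul, NormedSpace.exp_zero, one_mul] at h
    simp only [evolution_smul_single]
    exact hasDerivAt_pi.mp (hasDerivAt_pi.mp h a) b

variable {S A m : Type*} [Fintype S] [Fintype A] [DecidableEq A]

omit [Fintype S] [Fintype A] in
theorem onProbe_conjTranspose (X : Matrix S S ℂ) :
    (onProbe X : Matrix (S × A) (S × A) ℂ)ᴴ = onProbe Xᴴ := by
  rw [onProbe, Matrix.conjTranspose_kronecker, Matrix.conjTranspose_one, onProbe]

theorem onProbe_mul (X Y : Matrix S S ℂ) :
    (onProbe X * onProbe Y : Matrix (S × A) (S × A) ℂ) = onProbe (X * Y) := by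
  rw [onProbe, onProbe, ← Matrix.mul_kronecker_mul, Matrix.one_mul, onProbe]

omit [Fintype S] [Fintype A] in
theorem onProbe_one [DecidableEq S] : (onProbe (1 : Matrix S S ℂ) : Matrix (S × A) (S × A) ℂ) = 1 :=
  Matrix.one_kronecker_one

omit [Fintype S] [Fintype A] in
theorem IsGeneratedBy.onProbe [DecidableEq S] [DecidableEq m] {W : (m → ℝ) → Matrix S S ℂ}
    {Q : m → Matrix S S ℂ} (h : IsGeneratedBy W Q) :
    IsGeneratedBy (fun θ => (onProbe (W θ) : Matrix (S × A) (S × A) ℂ))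
      fun k => onProbe (Q k) := by
  refine ⟨by rw [h.map_zero, onProbe_one], fun j a b => ?_⟩
  have h1 := (h.hasDerivAt j a.1 b.1).mul_const ((1 : Matrix A A ℂ) a.2 b.2)
  change HasDerivAt (fun t : ℝ => W (t • Pi.single j 1) a.1 b.1 * (1 : Matrix A A ℂ) a.2 b.2)
    (-Complex.I * (Q j a.1 b.1 * (1 : Matrix A A ℂ) a.2 b.2)) 0
  rw [← mul_assoc]
  exact h1

theorem noisyOutput_eq (qs : PauliIdx n → ℝ) (ρ : Matrix (Qubits n) (Qubits n) ℂ) :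
    noisyOutput qs ρ = fun θ => noiseMap (fun k : PauliIdx n => pauli k.1) qs
      (evolution θ * ρ * (evolution θ)ᴴ) := rfl

theorem noisyOutputAnc_eq (qs : PauliIdx n → ℝ) (ρ : Matrix (Qubits n × A) (Qubits n × A) ℂ) :
    noisyOutputAnc qs ρ = fun θ => noiseMap (fun k : PauliIdx n => onProbe (pauli k.1)) qs
      (onProbe (evolution θ) * ρ * (onProbe (evolution θ))ᴴ) := rfl

omit [Fintype A] in
theorem onProbe_pauli_isHermitian (k : PauliIdx n) :
    (onProbe (pauli k.1) : Matrix (Qubits n × A) (Qubits n × A) ℂ).IsHermitian := by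
  rw [Matrix.IsHermitian, onProbe_conjTranspose, (pauli_isHermitian k.1).eq]

theorem onProbe_pauli_mul_self (k : PauliIdx n) :
    (onProbe (pauli k.1) * onProbe (pauli k.1) : Matrix (Qubits n × A) (Qubits n × A) ℂ) = 1 := by
  rw [onProbe_mul, pauli_mul_self, onProbe_one]

theorem isKet_maxEntangled : IsKet (maxEntangled n) := by
  rw [IsKet, dotProduct, Fintype.sum_prod_type]
  have h : ((Real.sqrt (2 ^ n))⁻¹ * (Real.sqrt (2 ^ n))⁻¹ : ℝ) = (2 ^ n)⁻¹ := by
    rw [← mul_inv, Real.mul_self_sqrt (by positivity)]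
  have h2 : ∀ x y : Qubits n, star (maxEntangled n) (x, y) * maxEntangled n (x, y) =
      if x = y then ((2 ^ n : ℝ)⁻¹ : ℂ) else 0 := by
    intro x y
    simp only [Pi.star_apply, maxEntangled]
    split_ifs with hxy
    · rw [RCLike.star_def, Complex.conj_ofReal, ← Complex.ofReal_mul, h]
      push_cast
      rfl
    · simp
  simp only [h2, Finset.sum_ite_eq, Finset.mem_univ, if_true, Finset.sum_const, Finset.card_univ]
  simp

/-- The reduced state of the probe is maximally mixed. -/
theorem prob_maxEntangled (X : Matrix (Qubits n) (Qubits n) ℂ) :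
    prob (ketbra (maxEntangled n)) (onProbe X) = (2 ^ n : ℝ)⁻¹ * X.trace.re := by
  have h : ((Real.sqrt (2 ^ n))⁻¹ * (Real.sqrt (2 ^ n))⁻¹ : ℝ) = (2 ^ n)⁻¹ := by
    rw [← mul_inv, Real.mul_self_sqrt (by positivity)]
  have h1 : star (maxEntangled n) ⬝ᵥ (onProbe X *ᵥ maxEntangled n) =
      (((2 ^ n : ℝ)⁻¹ : ℝ) : ℂ) * X.trace := by
    simp only [dotProduct, Matrix.mulVec, Fintype.sum_prod_type, onProbe,
      Matrix.kroneckerMap_apply, Pi.star_apply, maxEntangled, Matrix.one_apply, mul_ite, ite_mul,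
      mul_one, mul_zero, zero_mul, Finset.sum_ite_eq, Finset.mem_univ, if_true, apply_ite star,
      star_zero, RCLike.star_def, Complex.conj_ofReal, Matrix.trace, Matrix.diag_apply,
      Finset.mul_sum, ← h]
    push_cast
    exact Finset.sum_congr rfl fun x _ => by ring
  rw [prob_comm, prob, trace_mul_ketbra, h1, Complex.re_ofReal_mul]

/-- In the maximally mixed state nonidentity Paulis have mean zero and are orthonormal, so their
covariance matrix is the identity. -/
theorem variance_maxEntangled (c : PauliIdx n → ℝ) :
    variance (maxEntangled n) (∑ k, (c k : ℂ) • onProbe (pauli k.1)) = c ⬝ᵥ c := by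
  rw [variance_sum (Q := fun k : PauliIdx n => (onProbe (pauli k.1) :
    Matrix (Qubits n × Qubits n) (Qubits n × Qubits n) ℂ)), dotProduct]
  refine Finset.sum_congr rfl fun i _ => ?_
  have h2 : ((2 : ℂ) ^ n).re = 2 ^ n := by exact_mod_cast Complex.ofReal_re ((2 : ℝ) ^ n)
  rw [Finset.sum_eq_single i]
  · rw [onProbe_mul, prob_maxEntangled, prob_maxEntangled, trace_pauli i.2, trace_pauli_mul_pauli,
      if_pos rfl, h2, inv_mul_cancel₀ (by positivity)]
    simp
  · intro j _ hj
    rw [onProbe_mul, prob_maxEntangled, prob_maxEntangled, trace_pauli i.2, trace_pauli_mul_pauli,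
      if_neg fun h => hj (Subtype.ext h.symm)]
    simp
  · simp

end Evolution

/-! ### Relabelling of systems and outcomes -/

section Reindex

theorem prob_submatrix {S T : Type*} [Fintype S] [Fintype T] (e : T ≃ S) (A B : Matrix S S ℂ) :
    prob (A.submatrix e e) (B.submatrix e e) = prob A B := by
  rw [prob, Matrix.submatrix_mul_equiv, prob]
  congr 1
  exact Equiv.sum_comp e fun i => (A * B) i i

theorem cfim_submatrix {m S T X : Type*} [DecidableEq m] [Fintype S] [Fintype T] (e : T ≃ S)
    (ρ : (m → ℝ) → Matrix S S ℂ) (M : X → Matrix S S ℂ) (θ : m → ℝ) :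
    cfim (fun t => (ρ t).submatrix e e) (fun x => (M x).submatrix e e) θ = cfim ρ M θ := by
  simp only [cfim, prob_submatrix]

/-- Added outcomes carry the zero operator and have probability zero. This turns a finite
measurement into one indexed by `ℕ`, as `idealOptimum` requires. -/
theorem cfim_extend {m S X Y : Type*} [DecidableEq m] [Fintype S]
    (ρ : (m → ℝ) → Matrix S S ℂ) (M : X → Matrix S S ℂ) (θ : m → ℝ) {f : X → Y}
    (hf : Function.Injective f) : cfim ρ (Function.extend f M 0) θ = cfim ρ M θ := by
  ext i j
  simp only [cfim, Matrix.of_apply]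
  rw [← hf.tsum_eq]
  · simp only [hf.extend_apply]
  · intro y hy
    by_contra hy'
    refine hy ?_
    simp only [Function.extend_apply' M (0 : Y → Matrix S S ℂ) y hy']
    simp [prob]

theorem cfim_isHermitian {m S X : Type*} [DecidableEq m] [Fintype S]
    (ρ : (m → ℝ) → Matrix S S ℂ) (M : X → Matrix S S ℂ) (θ : m → ℝ) :
    (cfim ρ M θ).IsHermitian := by
  ext i j
  simp only [Matrix.conjTranspose_apply, cfim, Matrix.of_apply, star_trivial, mul_comm]

theorem IsThreeDesign.isPOVM {S ι : Type*} [Fintype S] [DecidableEq S] [Nonempty S] [Fintype ι]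
    {w : ι → ℝ} {v : ι → S → ℂ} (h : IsThreeDesign w v) : IsPOVM (designPOVM w v) := by
  refine ⟨fun s => (ketbra_posSemidef (v s)).smul (by
    exact_mod_cast mul_nonneg (h.pos s).le (Nat.cast_nonneg (α := ℝ) (Fintype.card S))), ?_⟩
  have h1 : ∑ s, designPOVM w v s = 1 := by
    have h2 : ∀ s, designPOVM w v s = (Fintype.card S : ℂ) • ((w s : ℂ) • ketbra (v s)) :=
      fun s => by rw [designPOVM, smul_smul, mul_comm]
    simp only [h2]
    rw [← Finset.smul_sum, h.resolution, smul_smul,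
      mul_inv_cancel₀ (by exact_mod_cast Fintype.card_ne_zero), one_smul]
  rw [← h1]
  exact hasSum_fintype _

end Reindex

/-! ### Lower bound on the noiseless optimum -/

section Optimum

variable {n : ℕ}

/-- The values `Tr(I⁻¹)` over which the noiseless optimum is taken. -/
def idealValues (n : ℕ) : Set ℝ :=
  {t : ℝ | ∃ (a : ℕ) (p : ℕ → ℝ) (ψ : ℕ → Qubits n × Fin a → ℂ)
    (M : ℕ → ℕ → Matrix (Qubits n × Fin a) (Qubits n × Fin a) ℂ),
    (∀ i, 0 ≤ p i) ∧ HasSum p 1 ∧ (∀ i, IsKet (ψ i)) ∧ (∀ i, IsPOVM (M i)) ∧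
    (idealEnsembleCfim p ψ M).PosDef ∧ t = (idealEnsembleCfim p ψ M)⁻¹.trace}

theorem card_div_four_le_of_mem_idealValues {t : ℝ} (ht : t ∈ idealValues n) :
    (Fintype.card (PauliIdx n) : ℝ) / 4 ≤ t := by
  obtain ⟨a, p, ψ, M, hp, hp1, hψ, hM, hpd, rfl⟩ := ht
  refine card_div_four_le_trace_inv hpd fun j => ?_
  have h1 := fun i => cfim_diag_le_four
    (IsGeneratedBy.onProbe (A := Fin a) (isGeneratedBy_evolution (n := n)))
    onProbe_pauli_isHermitian onProbe_pauli_mul_self (hψ i) (hM i) j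
  have h2 : ∀ i, p i * cfim (idealOutputAnc (ketbra (ψ i))) (M i) 0 j j ≤ p i * 4 := fun i =>
    mul_le_mul_of_nonneg_left (h1 i).2 (hp i)
  have h3 : ∀ i, 0 ≤ p i * cfim (idealOutputAnc (ketbra (ψ i))) (M i) 0 j j := fun i =>
    mul_nonneg (hp i) (h1 i).1
  have h4 := hp1.mul_right 4
  rw [one_mul] at h4
  exact (Summable.tsum_le_tsum h2 (h4.summable.of_nonneg_of_le h3 h2) h4.summable).trans
    h4.tsum_eq.le

/-- A finite noiseless ensemble with positive definite Fisher information matrix, on any system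
that is isomorphic to the probe and an ancilla, is a candidate for the noiseless optimum. -/
theorem idealValues_nonempty {S ι : Type*} [Fintype S] [DecidableEq S] [Fintype ι] [Nonempty ι]
    {a N : ℕ} (e : Qubits n × Fin a ≃ S) {p : ι → ℝ} (hp : ∀ i, 0 ≤ p i) (hp1 : ∑ i, p i = 1)
    {ψ : ι → S → ℂ} (hψ : ∀ i, IsKet (ψ i)) {ρ : ι → (PauliIdx n → ℝ) → Matrix S S ℂ}
    (hρ : ∀ i θ, idealOutputAnc (ketbra (ψ i ∘ e)) θ = (ρ i θ).submatrix e e)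
    {M : Fin N → Matrix S S ℂ} (hM : IsPOVM M)
    (hpd : (∑ i, p i • cfim (ρ i) M 0).PosDef) : (idealValues n).Nonempty := by
  classical
  obtain ⟨i₀⟩ := ‹Nonempty ι›
  let f : ι → ℕ := fun i => (Fintype.equivFin ι i : ℕ)
  have hf : Function.Injective f := Fin.val_injective.comp (Fintype.equivFin ι).injective
  let p' : ℕ → ℝ := Function.extend f p 0
  -- Indices outside the finite ensemble get weight zero but must still carry a unit vector, so a
  -- fixed member of the ensemble is repeated.
  let ψ' : ℕ → Qubits n × Fin a → ℂ := Function.extend f (fun i => ψ i ∘ e) fun _ => ψ i₀ ∘ e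
  let M' : ℕ → Matrix (Qubits n × Fin a) (Qubits n × Fin a) ℂ :=
    Function.extend Fin.val (fun s => (M s).submatrix e e) 0
  have hket : ∀ i, IsKet (ψ i ∘ e) := fun i =>
    (Equiv.sum_comp e fun x => star (ψ i) x * ψ i x).trans (hψ i)
  have hcases : ∀ k : ℕ, (∃ i, f i = k) ∨ ¬∃ i, f i = k := fun k => em _
  have hI : idealEnsembleCfim p' ψ' (fun _ => M') = ∑ i, p i • cfim (ρ i) M 0 := by
    ext j k
    simp only [idealEnsembleCfim, Matrix.of_apply]
    rw [← hf.tsum_eq, tsum_fintype, Matrix.sum_apply]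
    · refine Finset.sum_congr rfl fun i _ => ?_
      have h1 : cfim (idealOutputAnc (ketbra (ψ i ∘ e))) M' 0 = cfim (ρ i) M 0 := by
        rw [show idealOutputAnc (ketbra (ψ i ∘ e)) = fun θ => (ρ i θ).submatrix e e from
          funext (hρ i), cfim_extend _ _ _ Fin.val_injective, cfim_submatrix]
      simp only [p', ψ', hf.extend_apply, h1, Matrix.smul_apply, smul_eq_mul]
    · intro k hk
      by_contra hk'
      refine hk ?_
      simp only [p', Function.extend_apply' p (0 : ℕ → ℝ) k hk', Pi.zero_apply, zero_mul]
  refine ⟨_, a, p', ψ', fun _ => M', fun k => ?_, ?_, fun k => ?_, fun _ => ⟨fun k => ?_, ?_⟩, ?_,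
    rfl⟩
  · rcases hcases k with ⟨i, rfl⟩ | hk
    · simpa only [p', hf.extend_apply] using hp i
    · simp only [p', Function.extend_apply' p (0 : ℕ → ℝ) k hk, Pi.zero_apply, le_refl]
  · rw [hasSum_extend_zero hf, ← hp1]
    exact hasSum_fintype p
  · rcases hcases k with ⟨i, rfl⟩ | hk
    · simpa only [ψ', hf.extend_apply] using hket i
    · simpa only [ψ', Function.extend_apply' _ _ k hk] using hket i₀
  · by_cases hk : ∃ s : Fin N, s.val = k
    · obtain ⟨s, rfl⟩ := hk
      simp only [M', Fin.val_injective.extend_apply]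
      exact (hM.posSemidef s).submatrix e
    · simp only [M', Function.extend_apply' _ _ k hk]
      exact Matrix.PosSemidef.zero
  · rw [hasSum_extend_zero Fin.val_injective]
    have h1 := hM.hasSum_one.tsum_eq
    rw [tsum_fintype] at h1
    have h2 : ∑ s, (M s).submatrix e e = 1 := by
      ext x y
      have h3 := congrFun (congrFun h1 (e x)) (e y)
      rw [Matrix.sum_apply] at h3 ⊢
      rw [Matrix.one_apply] at h3 ⊢
      simpa using h3
    rw [← h2]
    exact hasSum_fintype _
  · rw [hI]
    exact hpd

/-- Nonemptiness is essential: the infimum of the empty set of reals is `0` by convention. -/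
theorem card_div_four_le_idealOptimum (h : (idealValues n).Nonempty) :
    (Fintype.card (PauliIdx n) : ℝ) / 4 ≤ idealOptimum n :=
  le_csInf h fun _ ht => card_div_four_le_of_mem_idealValues ht

end Optimum

/-! ### The two protocols and the constant `κ(q)` -/

section Protocols

variable {n : ℕ} {qs : PauliIdx n → ℝ}

theorem posSemidef_sub_smul_one {m : Type*} [Fintype m] [DecidableEq m] {A : Matrix m m ℝ}
    (hA : A.IsHermitian) {k : ℝ} (h : ∀ c : m → ℝ, k * (c ⬝ᵥ c) ≤ c ⬝ᵥ (A *ᵥ c)) :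
    (A - k • (1 : Matrix m m ℝ)).PosSemidef := by
  refine Matrix.PosSemidef.of_dotProduct_mulVec_nonneg ?_ fun c => ?_
  · rw [Matrix.IsHermitian, Matrix.conjTranspose_sub, hA.eq, Matrix.conjTranspose_smul,
      Matrix.conjTranspose_one]
    simp
  · rw [Matrix.sub_mulVec, Matrix.smul_mulVec, Matrix.one_mulVec, dotProduct_sub, dotProduct_smul,
      star_trivial, smul_eq_mul]
    exact sub_nonneg.mpr (h c)

theorem card_qubits : (Fintype.card (Qubits n) : ℝ) = 2 ^ n := by simp

/-- The bound on the Fisher information matrix of the maximally entangled protocol. -/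
theorem maxEntangledCfim_ge (hqs : ∀ k, 0 ≤ qs k) (hq : ∑ k, qs k < 1 / 2) {N : ℕ}
    {w : Fin N → ℝ} {v : Fin N → Qubits n × Qubits n → ℂ} (hd : IsThreeDesign w v)
    (c : PauliIdx n → ℝ) :
    (1 - 2 * ∑ k, qs k) ^ 2 * ((((2 : ℝ) ^ n) ^ 2 + 2) / ((2 ^ n) ^ 2 + 1)) * (c ⬝ᵥ c) ≤
      c ⬝ᵥ (maxEntangledCfim qs (designPOVM w v) *ᵥ c) := by
  have h := hd.le_cfim_noiseMap (IsGeneratedBy.onProbe (isGeneratedBy_evolution (n := n)))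
    onProbe_pauli_isHermitian onProbe_pauli_mul_self hqs hq isKet_maxEntangled c
  rw [variance_maxEntangled, Fintype.card_prod, Nat.cast_mul, card_qubits, ← sq] at h
  exact h

/-- The bound on the Fisher information matrix of the random stabilizer protocol. -/
theorem stabilizerCfim_ge (hqs : ∀ k, 0 ≤ qs k) (hq : ∑ k, qs k < 1 / 2) {N : ℕ}
    {w : Fin N → ℝ} {v : Fin N → Qubits n → ℂ} (hd : IsThreeDesign w v)
    (c : PauliIdx n → ℝ) :
    (1 - 2 * ∑ k, qs k) ^ 2 * (((2 : ℝ) ^ n + 2) / (2 ^ n + 1)) *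
      (((2 : ℝ) ^ n / (2 ^ n + 1)) * (c ⬝ᵥ c)) ≤
      c ⬝ᵥ (stabilizerCfim qs (designPOVM w v) *ᵥ c) := by
  have h := fun C : CliffordClass n => hd.le_cfim_noiseMap (isGeneratedBy_evolution (n := n))
    (fun k => pauli_isHermitian k.1) (fun k => pauli_mul_self k.1) hqs hq
    (isKet_stabilizerKet C) c
  have hC : (0 : ℝ) < Fintype.card (CliffordClass n) := by exact_mod_cast Fintype.card_pos
  have h1 := Finset.sum_le_sum fun C (_ : C ∈ Finset.univ) =>
    mul_le_mul_of_nonneg_left (h C) (inv_pos.mpr hC).le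
  rw [← Finset.mul_sum, ← Finset.mul_sum, sum_variance_stabilizer, card_qubits] at h1
  have h2 : c ⬝ᵥ (stabilizerCfim qs (designPOVM w v) *ᵥ c) =
      ∑ C : CliffordClass n, (Fintype.card (CliffordClass n) : ℝ)⁻¹ *
        (c ⬝ᵥ (cfim (noisyOutput qs (ketbra (stabilizerKet C))) (designPOVM w v) 0 *ᵥ c)) := by
    rw [stabilizerCfim, Matrix.sum_mulVec, dotProduct_sum]
    simp only [Matrix.smul_mulVec, dotProduct_smul, smul_eq_mul]
  rw [h2]
  refine le_trans (le_of_eq ?_) h1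
  field_simp

theorem stabilizerCfim_isHermitian {X : Type*} (M : X → Matrix (Qubits n) (Qubits n) ℂ) :
    (stabilizerCfim qs M).IsHermitian := by
  rw [Matrix.IsHermitian, stabilizerCfim, Matrix.conjTranspose_sum]
  simp only [Matrix.conjTranspose_smul, (cfim_isHermitian _ _ _).eq, star_trivial]

/-- The protocol itself, run without noise, is a candidate: the lower bound at zero rates shows that
its Fisher matrix is positive definite. -/
theorem idealValues_nonempty_of_design_sq {N : ℕ} {w : Fin N → ℝ}
    {v : Fin N → Qubits n × Qubits n → ℂ} (hd : IsThreeDesign w v) :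
    (idealValues n).Nonempty := by
  have hpd : (maxEntangledCfim (n := n) 0 (designPOVM w v)).PosDef := by
    refine posDef_of_sub_smul_one (c := (((2 : ℝ) ^ n) ^ 2 + 2) / ((2 ^ n) ^ 2 + 1))
      (by positivity) (posSemidef_sub_smul_one (cfim_isHermitian _ _ _) fun c => ?_)
    simpa [maxEntangledCfim] using maxEntangledCfim_ge (qs := 0) (by simp) (by simp) hd c
  let e : Qubits n × Fin (Fintype.card (Qubits n)) ≃ Qubits n × Qubits n :=
    Equiv.prodCongr (Equiv.refl _) (Fintype.equivFin (Qubits n)).symm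
  refine idealValues_nonempty (ι := Unit) e (p := fun _ => 1) (by simp) (by simp)
    (ψ := fun _ => maxEntangled n) (fun _ => isKet_maxEntangled)
    (ρ := fun _ => noisyOutputAnc 0 (ketbra (maxEntangled n))) (fun _ θ => ?_) hd.isPOVM ?_
  · rw [noisyOutputAnc_eq]
    simp only [noiseMap_zero_rates]
    have h1 : (onProbe (evolution θ) : Matrix (Qubits n × Qubits n) _ ℂ).submatrix e e =
        onProbe (evolution θ) := by
      ext x y
      simp [onProbe, Matrix.kroneckerMap_apply, Matrix.one_apply, e]
    rw [idealOutputAnc, ← h1, ← Matrix.submatrix_mul_equiv _ _ e e e,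
      ← Matrix.submatrix_mul_equiv _ _ e e e, Matrix.conjTranspose_submatrix]
    rfl
  · simpa [maxEntangledCfim] using hpd

/-- The noiseless stabilizer protocol is the candidate here, with a one-dimensional ancilla. This
avoids assuming a design on the doubled space. -/
theorem idealValues_nonempty_of_design {N : ℕ} {w : Fin N → ℝ}
    {v : Fin N → Qubits n → ℂ} (hd : IsThreeDesign w v) :
    (idealValues n).Nonempty := by
  have hpd : (stabilizerCfim (n := n) 0 (designPOVM w v)).PosDef := by
    refine posDef_of_sub_smul_one
      (c := (((2 : ℝ) ^ n + 2) / (2 ^ n + 1)) * ((2 : ℝ) ^ n / (2 ^ n + 1)))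
      (by positivity) (posSemidef_sub_smul_one (stabilizerCfim_isHermitian _) fun c => ?_)
    have := stabilizerCfim_ge (qs := 0) (by simp) (by simp) hd c
    simpa [mul_assoc] using this
  let e : Qubits n × Fin 1 ≃ Qubits n := Equiv.prodUnique _ _
  refine idealValues_nonempty (ι := CliffordClass n) e
    (p := fun _ => (Fintype.card (CliffordClass n) : ℝ)⁻¹) (fun _ => by positivity) (by simp)
    (ψ := stabilizerKet) isKet_stabilizerKet
    (ρ := fun C => noisyOutput 0 (ketbra (stabilizerKet C))) (fun C θ => ?_) hd.isPOVM hpd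
  rw [noisyOutput_eq]
  simp only [noiseMap_zero_rates]
  have h1 : (evolution θ).submatrix e e = (onProbe (evolution θ) :
      Matrix (Qubits n × Fin 1) (Qubits n × Fin 1) ℂ) := by
    ext x y
    simp [onProbe, Matrix.kroneckerMap_apply, Matrix.one_apply, e, Subsingleton.elim x.2 y.2]
  rw [idealOutputAnc, ← h1, ← Matrix.submatrix_mul_equiv _ _ e e e,
    ← Matrix.submatrix_mul_equiv _ _ e e e, Matrix.conjTranspose_submatrix]
  rfl

theorem noiseConst_pos {q : ℝ} (h : q < 1 / 4) : 0 < noiseConst q := by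
  unfold noiseConst
  have h1 : 0 < 1 - q := by linarith
  have h2 : 0 < 1 - 4 * q := by linarith
  have h3 : 0 < 2 - q := by linarith
  positivity

/-- The chain is `4κ = (2(1 - q)²/(2 - q)) (1 - 4q) ≤ 1 - 4q ≤ (1 - 2q)²`. Thus `κ` is weaker than
the constant that the proof produces. -/
theorem four_mul_noiseConst_le {q : ℝ} (h0 : 0 ≤ q) (h : q < 1 / 4) :
    4 * noiseConst q ≤ (1 - 2 * q) ^ 2 := by
  have h3 : 0 < 2 - q := by linarith
  have e : 4 * noiseConst q = (2 * (1 - q) ^ 2 / (2 - q)) * (1 - 4 * q) := by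
    unfold noiseConst
    field_simp
    ring
  have h4 : 2 * (1 - q) ^ 2 / (2 - q) ≤ 1 := by
    rw [div_le_one h3]
    nlinarith
  have h5 := mul_le_mul_of_nonneg_right h4 (show 0 ≤ 1 - 4 * q by linarith)
  rw [e]
  nlinarith [sq_nonneg q]

end Protocols

end

end HamEst

theorem mainTheorem7 (n : ℕ) (qs : HamEst.PauliIdx n → ℝ) (hqs : ∀ k, 0 ≤ qs k)
    (q : ℝ) (hq : q = ∑ k, qs k) (hhalf : q < 1 / 2) (hsmall : q < (1 - 2 * q) ^ 2)
    (d : ℝ) (hd : d = 2 ^ n) :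
    0 < HamEst.noiseConst q ∧
    (∀ (N : ℕ) (w : Fin N → ℝ) (v : Fin N → HamEst.Qubits n × HamEst.Qubits n → ℂ),
      HamEst.IsThreeDesign w v →
        (HamEst.maxEntangledCfim qs (HamEst.designPOVM w v) -
          (HamEst.noiseConst q * ((d ^ 2 + 2) / (d ^ 2 + 1)) * 4) •
            (1 : Matrix (HamEst.PauliIdx n) (HamEst.PauliIdx n) ℝ)).PosSemidef ∧
        (HamEst.maxEntangledCfim qs (HamEst.designPOVM w v)).PosDef ∧
        (HamEst.maxEntangledCfim qs (HamEst.designPOVM w v))⁻¹.trace ≤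
          (HamEst.noiseConst q)⁻¹ * HamEst.idealOptimum n) ∧
    (∀ (N : ℕ) (w : Fin N → ℝ) (v : Fin N → HamEst.Qubits n → ℂ),
      HamEst.IsThreeDesign w v →
        (HamEst.stabilizerCfim qs (HamEst.designPOVM w v) -
          (HamEst.noiseConst q * ((d + 2) / (d + 1)) * (4 * (d / (d + 1)))) •
            (1 : Matrix (HamEst.PauliIdx n) (HamEst.PauliIdx n) ℝ)).PosSemidef ∧
        (HamEst.stabilizerCfim qs (HamEst.designPOVM w v)).PosDef ∧
        (HamEst.stabilizerCfim qs (HamEst.designPOVM w v))⁻¹.trace ≤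
          (HamEst.noiseConst q)⁻¹ * ((d + 1) / d) * HamEst.idealOptimum n) := by
  have hq0 : 0 ≤ q := hq ▸ Finset.sum_nonneg fun k _ => hqs k
  -- The condition `q < (1 - 2q)²` reads `(1 - 4q)(1 - q) > 0`, and `q < 1/2` selects the branch
  -- below `1/4`.
  have hq4 : q < 1 / 4 := by
    by_contra! h
    nlinarith
  have hκ := HamEst.noiseConst_pos hq4
  have hκ4 := HamEst.four_mul_noiseConst_le hq0 hq4
  have hd0 : 0 < d := hd ▸ by positivity
  have hsum : ∑ k, qs k < 1 / 2 := hq ▸ hhalf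
  set κ := HamEst.noiseConst q
  refine ⟨hκ, fun N w v hdes => ?_, fun N w v hdes => ?_⟩
  · have hpsd : (HamEst.maxEntangledCfim qs (HamEst.designPOVM w v) -
        (κ * ((d ^ 2 + 2) / (d ^ 2 + 1)) * 4) •
          (1 : Matrix (HamEst.PauliIdx n) (HamEst.PauliIdx n) ℝ)).PosSemidef := by
      refine HamEst.posSemidef_sub_smul_one (HamEst.cfim_isHermitian _ _ _) fun c => ?_
      refine le_trans ?_ (HamEst.maxEntangledCfim_ge hqs hsum hdes c)
      rw [← hq, ← hd]
      have hc : 0 ≤ c ⬝ᵥ c := dotProduct_self_star_nonneg c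
      calc κ * ((d ^ 2 + 2) / (d ^ 2 + 1)) * 4 * (c ⬝ᵥ c)
          = 4 * κ * ((d ^ 2 + 2) / (d ^ 2 + 1)) * (c ⬝ᵥ c) := by ring
        _ ≤ _ := by gcongr
    have hpos : 0 < κ * ((d ^ 2 + 2) / (d ^ 2 + 1)) * 4 := by positivity
    refine ⟨hpsd, HamEst.posDef_of_sub_smul_one hpos hpsd, (HamEst.trace_inv_le hpos hpsd).trans ?_⟩
    have hw := HamEst.card_div_four_le_idealOptimum
      (HamEst.idealValues_nonempty_of_design_sq hdes)
    -- The design factor exceeds `1`, so dropping it from the denominator only weakens the trace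
    -- bound.
    have h1 : 1 ≤ (d ^ 2 + 2) / (d ^ 2 + 1) := by
      rw [one_le_div (by positivity)]
      linarith
    calc (Fintype.card (HamEst.PauliIdx n) : ℝ) / (κ * ((d ^ 2 + 2) / (d ^ 2 + 1)) * 4)
        ≤ Fintype.card (HamEst.PauliIdx n) / (κ * 1 * 4) := by gcongr
      _ = κ⁻¹ * (Fintype.card (HamEst.PauliIdx n) / 4) := by field_simp
      _ ≤ _ := by gcongr
  · have hpsd : (HamEst.stabilizerCfim qs (HamEst.designPOVM w v) -
        (κ * ((d + 2) / (d + 1)) * (4 * (d / (d + 1)))) •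
          (1 : Matrix (HamEst.PauliIdx n) (HamEst.PauliIdx n) ℝ)).PosSemidef := by
      refine HamEst.posSemidef_sub_smul_one (HamEst.stabilizerCfim_isHermitian _) fun c => ?_
      refine le_trans ?_ (HamEst.stabilizerCfim_ge hqs hsum hdes c)
      rw [← hq, ← hd]
      have hc : 0 ≤ c ⬝ᵥ c := dotProduct_self_star_nonneg c
      calc κ * ((d + 2) / (d + 1)) * (4 * (d / (d + 1))) * (c ⬝ᵥ c)
          = 4 * κ * ((d + 2) / (d + 1)) * (d / (d + 1) * (c ⬝ᵥ c)) := by ring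
        _ ≤ _ := by gcongr
    have hpos : 0 < κ * ((d + 2) / (d + 1)) * (4 * (d / (d + 1))) := by positivity
    refine ⟨hpsd, HamEst.posDef_of_sub_smul_one hpos hpsd, (HamEst.trace_inv_le hpos hpsd).trans ?_⟩
    have hw := HamEst.card_div_four_le_idealOptimum
      (HamEst.idealValues_nonempty_of_design hdes)
    have h1 : 1 ≤ (d + 2) / (d + 1) := by
      rw [one_le_div (by positivity)]
      linarith
    calc (Fintype.card (HamEst.PauliIdx n) : ℝ) / (κ * ((d + 2) / (d + 1)) * (4 * (d / (d + 1))))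
        ≤ Fintype.card (HamEst.PauliIdx n) / (κ * 1 * (4 * (d / (d + 1)))) := by gcongr
      _ = κ⁻¹ * ((d + 1) / d) * (Fintype.card (HamEst.PauliIdx n) / 4) := by field_simp
      _ ≤ _ := by gcongr
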